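/- Fix an integer $d\ge 2$ and $a,b\in\mathbb R^d$ with $a_i<b_i$ for all $i$, and let $[a,b]=\prod_{i}[a_i,b_i]$. Let $|\cdot|$ denote the maximum norm on $\mathbb R^d$. A function $f:[a,b]\to\mathbb R^d$ is *positive-switching* if for all $x\in[a,b]$ and all $i$: $x_i=a_i$ implies $f_i(x)\le 0$, and $x_i=b_i$ implies $f_i(x)\ge 0$. It satisfies *all ex-diagonal conditions* if for all $i\ne j$ the component $f_i$ is weakly decreasing in the variable $x_j$ (the other variables being fixed). For $\delta>0$, a function $f:[a,b]\to\{-1,0,1\}^d$ is *$\delta$-continuous* if $|x-x'|\le\delta$ implies $|f(x)-f(x')|\le 1$. For $\varepsilon,L>0$, a function $f:[a,b]\to\mathbb R^d$ is *$(\varepsilon,L)$-Lipschitz* if $|x-x'|\le\varepsilon/L$ implies $|f(x)-f(x')|\le\varepsilon$. A *root* is a point $x\in[a,b]$ with $f(x)=0$, and an *$\varepsilon$-root* is a point $x\in[a,b]$ with $|f(x)|\le\varepsilon$. An algorithm accesses $f$ only through adaptive evaluation queries (given $x\in[a,b]$, the answer is the vector $f(x)$), and its cost is the number of evaluations in the worst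 case. There is a constant $C$ that depends only on $d,a,b$ such that, with $k=\lceil (d+1)/2\rceil$: 1. For every $\delta>0$ there is a deterministic algorithm that, for every positive-switching $\delta$-continuous $f:[a,b]\to\{-1,0,1\}^d$ satisfying all ex-diagonal conditions, finds a root of $f$ using at most $C\max(1,\log(1/\delta))^{k}$ evaluations, that is, $O(\log^{\lceil (d+1)/2\rceil}(1/\delta))$ evaluations. 2. For all $\varepsilon,L>0$ there is a deterministic algorithm that, for every positive-switching $(\varepsilon,L)$-Lipschitz $f:[a,b]\to\mathbb R^d$ satisfying all ex-diagonal conditions, finds an $\varepsilon$-root of $f$ using at most $C\max(1,\log(L/\varepsilon))^{k}$ evaluations, that is, $O(\log^{\lceil (d+1)/2\rceil}(L/\varepsilon))$ evaluations. 3. The same as in 2 holds for the positive-switching functions satisfying all ex-diagonal conditions that are Lipschitz-continuous with constant $L$ in the maximum norm. -/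

import Mathlib

namespace RootFinding

/-- A deterministic adaptive algorithm whose only access to an unknown function `f : X → Y` is
through evaluation queries.  It either stops and returns a point of `X`, or asks for the value of
`f` at some point and continues in a way that depends on the answer. -/
inductive QueryAlg (X Y : Type) : Type
  | output (x : X) : QueryAlg X Y
  | query (x : X) (next : Y → QueryAlg X Y) : QueryAlg X Y

/-- The point returned by the algorithm when it is run on `f`. -/
def QueryAlg.result {X Y : Type} (f : X → Y) : QueryAlg X Y → X
  | .output x => x
  | .query x next => (next (f x)).result f

/-- The number of evaluations of `f` made by the algorithm when it is run on `f`. -/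
def QueryAlg.evaluations {X Y : Type} (f : X → Y) : QueryAlg X Y → ℕ
  | .output _ => 0
  | .query x next => (next (f x)).evaluations f + 1

variable {d : ℕ} {a b : Fin d → ℝ}

/-- `f i` is nonpositive on the face `x i = a i` and nonnegative on the face `x i = b i`,
for each `i`. -/
def PositiveSwitching (f : Set.Icc a b → (Fin d → ℝ)) : Prop :=
  ∀ (x : Set.Icc a b) (i : Fin d),
    (x.1 i = a i → f x i ≤ 0) ∧ (x.1 i = b i → 0 ≤ f x i)

/-- The component `f i` is weakly decreasing in the variable `x j`, whatever the fixed values of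
the other variables. -/
def DecreasingIn (f : Set.Icc a b → (Fin d → ℝ)) (i j : Fin d) : Prop :=
  ∀ x y : Set.Icc a b, (∀ k, k ≠ j → x.1 k = y.1 k) → x.1 j ≤ y.1 j → f y i ≤ f x i

/-- All `d ^ 2 - d` ex-diagonal monotonicity conditions. -/
def ExDiagonalDecreasing (f : Set.Icc a b → (Fin d → ℝ)) : Prop :=
  ∀ i j : Fin d, i ≠ j → DecreasingIn f i j

/-- Every component of `f` takes its values in `{-1, 0, 1}`. -/
def SignValued (f : Set.Icc a b → (Fin d → ℝ)) : Prop :=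
  ∀ (x : Set.Icc a b) (i : Fin d), f x i = -1 ∨ f x i = 0 ∨ f x i = 1

/-- A `{-1, 0, 1}`-valued function that changes by at most `1` over distances at most `δ`
(the norm on `Fin d → ℝ` is the maximum norm). -/
def DeltaContinuous (δ : ℝ) (f : Set.Icc a b → (Fin d → ℝ)) : Prop :=
  SignValued f ∧ ∀ x x' : Set.Icc a b, ‖x.1 - x'.1‖ ≤ δ → ‖f x - f x'‖ ≤ 1

/-- The Lipschitz condition at the single scale `ε / L`; it does not imply continuity. -/
def ScaleLipschitz (ε L : ℝ) (f : Set.Icc a b → (Fin d → ℝ)) : Prop :=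
  ∀ x x' : Set.Icc a b, ‖x.1 - x'.1‖ ≤ ε / L → ‖f x - f x'‖ ≤ ε

/-- `x` is a root of `f`. -/
def IsRoot (f : Set.Icc a b → (Fin d → ℝ)) (x : Set.Icc a b) : Prop := f x = 0

/-- `x` is an `ε`-root of `f` in the maximum norm. -/
def IsApproxRoot (ε : ℝ) (f : Set.Icc a b → (Fin d → ℝ)) (x : Set.Icc a b) : Prop := ‖f x‖ ≤ ε

end RootFinding

/-! Put a grid with `2 ^ K` steps per direction on `[a, b]` and let `g` move each index by the sign
of `-f i`, values in `[-η, η]` counting as zero. The ex-diagonal conditions, and the fact that `f i`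
cannot pass from above `η` to below `-η` within one grid step, make `g` monotone (`gridMove_mono`).
Positive switching moves the extreme corners inwards, and a fixed point of `g` has all `|f i| ≤ η`.
So a Tarski fixed point is sought, with `K` of order `log (1 / δ)`. A dummy coordinate, if needed,
makes the dimension odd, `2 * m + 1` with `m = d / 2`; then `m + 1 = ⌈(d + 1) / 2⌉`.

A point `x` of the middle slice `x t = c` with `x ≤ g x` or `g x ≤ x` halves the box. This costs one
factor `K`, and it remains to find such points in slices of dimension `2 * m` with `O(K ^ m)`
evaluations (`sliceSolvable_of_card`). There the direction `t` enters only through the monotone sign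
of `c ≤ g x t`.

In a planar slice (`solves_planar`), a box with certificates at its lower left and upper right
corners is halved by boundedly many queries. An edge certificate works because `f` drops by at most
one per step: between its ends `f` vanishes at a point with `b = 1`, where either the signs agree or
`f` and `g` are both nonpositive.

In higher dimension (`SliceSolvable.insert_insert`) the planar procedure runs on two coordinates,
and each of its queries is answered by slice problems in the other coordinates. These have many
solutions, so consistency is the issue. All solutions found are recorded, and each new problem is
confined to the box between the join of the recorded up points below `z` and the meet of the down
points above `z`. Then all answers are signs of a single monotone planar function, defined by the
joins of the final records. -/

namespace RootFinding

/-! ### Query procedures and their composition. -/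

/-- A deterministic adaptive procedure that evaluates an unknown function `f : X → Y` and returns
a value of an arbitrary type `R`. -/
inductive QueryTree (X Y R : Type) : Type
  | pure (r : R) : QueryTree X Y R
  | ask (x : X) (next : Y → QueryTree X Y R) : QueryTree X Y R

namespace QueryTree

variable {X Y R R' : Type}

/-- The value returned when the procedure is run on `f`. -/
def result (f : X → Y) : QueryTree X Y R → R
  | .pure r => r
  | .ask x next => (next (f x)).result f

/-- The number of evaluations made when the procedure is run on `f`. -/
def cost (f : X → Y) : QueryTree X Y R → ℕ
  | .pure _ => 0
  | .ask x next => (next (f x)).cost f + 1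

/-- Sequential composition. -/
def bind : QueryTree X Y R → (R → QueryTree X Y R') → QueryTree X Y R'
  | .pure r, k => k r
  | .ask x next, k => .ask x fun y => (next y).bind k

theorem result_bind (f : X → Y) (T : QueryTree X Y R) (k : R → QueryTree X Y R') :
    (T.bind k).result f = (k (T.result f)).result f := by
  induction T with
  | pure r => rfl
  | ask x next ih => exact ih _

theorem cost_bind (f : X → Y) (T : QueryTree X Y R) (k : R → QueryTree X Y R') :
    (T.bind k).cost f = T.cost f + (k (T.result f)).cost f := by
  induction T with
  | pure r => simp [bind, cost, result]
  | ask x next ih =>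
    have := ih (f x)
    simp only [bind, cost, result] at this ⊢
    omega

/-- A procedure that returns a point of `X`, as a `QueryAlg`. -/
def toAlg : QueryTree X Y X → QueryAlg X Y
  | .pure r => .output r
  | .ask x next => .query x fun y => (next y).toAlg

theorem result_toAlg (f : X → Y) (T : QueryTree X Y X) : T.toAlg.result f = T.result f := by
  induction T with
  | pure r => rfl
  | ask x next ih => exact ih _

theorem evaluations_toAlg (f : X → Y) (T : QueryTree X Y X) :
    T.toAlg.evaluations f = T.cost f := by
  induction T with
  | pure r => rfl
  | ask x next ih => exact congrArg (· + 1) (ih _)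

/-- Simulation of a procedure for functions `X → Y` by one for functions `X' → Y'`: a query `x` is
replaced by the query `φ x`, and the answer `y` is decoded as `ψ x y`. -/
def simulate {X' Y' : Type} (φ : X → X') (ψ : X → Y' → Y) (ρ : R → R') :
    QueryTree X Y R → QueryTree X' Y' R'
  | .pure r => .pure (ρ r)
  | .ask x next => .ask (φ x) fun y => (next (ψ x y)).simulate φ ψ ρ

theorem result_simulate {X' Y' : Type} (φ : X → X') (ψ : X → Y' → Y) (ρ : R → R')
    (f : X' → Y') (T : QueryTree X Y R) :
    (T.simulate φ ψ ρ).result f = ρ (T.result fun x => ψ x (f (φ x))) := by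
  induction T with
  | pure r => rfl
  | ask x next ih => exact ih _

theorem cost_simulate {X' Y' : Type} (φ : X → X') (ψ : X → Y' → Y) (ρ : R → R')
    (f : X' → Y') (T : QueryTree X Y R) :
    (T.simulate φ ψ ρ).cost f = T.cost fun x => ψ x (f (φ x)) := by
  induction T with
  | pure r => rfl
  | ask x next ih => exact congrArg (· + 1) (ih _)

end QueryTree

variable {X Y R R' : Type}

/-- Some procedure makes at most `n` evaluations on every `f` with `K f` and returns an `r` with
`G f r`. -/
def Solves (n : ℕ) (K : (X → Y) → Prop) (G : (X → Y) → R → Prop) : Prop :=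
  ∃ T : QueryTree X Y R, ∀ f, K f → G f (T.result f) ∧ T.cost f ≤ n

namespace Solves

variable {n m : ℕ} {K K' : (X → Y) → Prop} {G : (X → Y) → R → Prop} {G' : (X → Y) → R' → Prop}

theorem pure (r : R) (h : ∀ f, K f → G f r) : Solves n K G :=
  ⟨.pure r, fun f hf => ⟨h f hf, Nat.zero_le _⟩⟩

theorem ask (x : X) (h : ∀ y, Solves n (fun f => K f ∧ f x = y) G) : Solves (n + 1) K G := by
  choose T hT using h
  exact ⟨.ask x T, fun f hf => ⟨(hT _ f ⟨hf, rfl⟩).1, Nat.succ_le_succ (hT _ f ⟨hf, rfl⟩).2⟩⟩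

theorem bind (h : Solves n K G) (h' : ∀ r, Solves m (fun f => K f ∧ G f r) G') :
    Solves (n + m) K G' := by
  obtain ⟨T, hT⟩ := h
  choose T' hT' using h'
  refine ⟨T.bind T', fun f hf => ?_⟩
  rw [QueryTree.result_bind, QueryTree.cost_bind]
  obtain ⟨h1, h2⟩ := hT f hf
  obtain ⟨h3, h4⟩ := hT' _ f ⟨hf, h1⟩
  exact ⟨h3, Nat.add_le_add h2 h4⟩

theorem mono {G₁ : (X → Y) → R → Prop} (h : Solves n K G) (hn : n ≤ m) (hK : ∀ f, K' f → K f)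
    (hG : ∀ f r, K' f → G f r → G₁ f r) : Solves m K' G₁ := by
  obtain ⟨T, hT⟩ := h
  exact ⟨T, fun f hf => ⟨hG f _ hf (hT f (hK f hf)).1, (hT f (hK f hf)).2.trans hn⟩⟩

/-- Evaluate `f` on a finite set that determines which return values are correct. -/
theorem of_determined [Nonempty R] [DecidableEq X] (Q : Finset X) (hQ : Q.card ≤ n)
    (hex : ∀ f, K f → ∃ r, G f r)
    (hdet : ∀ f f' r, K f → K f' → (∀ x ∈ Q, f x = f' x) → G f r → G f' r) :
    Solves n K G := by
  induction Q using Finset.induction_on generalizing n K with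
  | empty =>
    -- Once the values on `Q` are known, an answer that is right for one compatible function is
    -- right for all of them.
    by_cases h : ∃ f, K f
    · obtain ⟨f, hf⟩ := h
      obtain ⟨r, hr⟩ := hex f hf
      exact pure r fun f' hf' => hdet f f' r hf hf' (by simp) hr
    · exact pure (Classical.arbitrary R) fun f hf => (h ⟨f, hf⟩).elim
  | insert x Q hx ih =>
    rw [Finset.card_insert_of_notMem hx] at hQ
    obtain ⟨n, rfl⟩ : ∃ k, n = k + 1 := ⟨n - 1, by omega⟩
    refine ask x fun y => ih (by omega) (fun f hf => hex f hf.1) ?_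
    intro f f' r hf hf' hff' hr
    refine hdet f f' r hf.1 hf'.1 ?_ hr
    intro x' hx'
    rcases Finset.mem_insert.1 hx' with rfl | h
    · rw [hf.2, hf'.2]
    · exact hff' x' h

end Solves
end RootFinding

/-! ### Planar problem: certificates at the corners of a box. -/

namespace RootFinding

/-- Two components `f`, `g` of a monotone sign function on the planar grid, and a further monotone
sign `b`. -/
structure MonoSigns (f g b : ℤ → ℤ → ℤ) : Prop where
  f_mono : ∀ x y x' y', x ≤ x' → y ≤ y' → x + f x y ≤ x' + f x' y'
  g_mono : ∀ x y x' y', x ≤ x' → y ≤ y' → y + g x y ≤ y' + g x' y'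
  b_mono : ∀ x y x' y', x ≤ x' → y ≤ y' → b x y ≤ b x' y'
  f_bound : ∀ x y, -1 ≤ f x y ∧ f x y ≤ 1
  g_bound : ∀ x y, -1 ≤ g x y ∧ g x y ≤ 1
  b_val : ∀ x y, b x y = -1 ∨ b x y = 1

/-- All three signs at `(x, y)` agree weakly. -/
def Agree (f g b : ℤ → ℤ → ℤ) (x y : ℤ) : Prop :=
  (0 ≤ f x y ∧ 0 ≤ g x y ∧ b x y = 1) ∨ (f x y ≤ 0 ∧ g x y ≤ 0 ∧ b x y = -1)

/-- A certificate at the upper right corner `(u, v)` of a box: the signs are nonpositive there, or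
the edge from `(p, q)` to `(u, v)` has a sign change. -/
def Top (f g b : ℤ → ℤ → ℤ) (u v p q : ℤ) : Prop :=
  (p = u ∧ q = v ∧ f u v ≤ 0 ∧ g u v ≤ 0) ∨
  (q = v ∧ b p q = 1 ∧ 0 ≤ f p q ∧ g p q ≤ 0 ∧ f u v ≤ 0) ∨
  (p = u ∧ b p q = 1 ∧ 0 ≤ g p q ∧ f p q ≤ 0 ∧ g u v ≤ 0)

/-- A certificate at the lower left corner of a box, dual to `Top`. -/
def Bot (f g b : ℤ → ℤ → ℤ) (u v p q : ℤ) : Prop :=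
  (p = u ∧ q = v ∧ 0 ≤ f u v ∧ 0 ≤ g u v) ∨
  (q = v ∧ b p q = -1 ∧ f p q ≤ 0 ∧ 0 ≤ g p q ∧ 0 ≤ f u v) ∨
  (p = u ∧ b p q = -1 ∧ g p q ≤ 0 ∧ 0 ≤ f p q ∧ 0 ≤ g u v)

/-- Certificates `p` and `q` at the upper and lower corners of the box `[(l₁, l₂), (u₁, u₂)]`, all
coordinates being taken from `X` and `Y`. -/
structure Cert (f g b : ℤ → ℤ → ℤ) (X Y : Set ℤ) (l₁ l₂ u₁ u₂ p₁ p₂ q₁ q₂ : ℤ) : Prop where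
  mem₁ : l₁ ∈ X ∧ u₁ ∈ X ∧ p₁ ∈ X ∧ q₁ ∈ X
  mem₂ : l₂ ∈ Y ∧ u₂ ∈ Y ∧ p₂ ∈ Y ∧ q₂ ∈ Y
  le₁ : l₁ ≤ p₁ ∧ p₁ ≤ u₁ ∧ l₁ ≤ q₁ ∧ q₁ ≤ u₁
  le₂ : l₂ ≤ p₂ ∧ p₂ ≤ u₂ ∧ l₂ ≤ q₂ ∧ q₂ ≤ u₂
  top : Top f g b u₁ u₂ p₁ p₂
  bot : Bot f g b l₁ l₂ q₁ q₂

/-- Some point of the box with coordinates in `X` and `Y` has weakly agreeing signs. -/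
def HasAgree (f g b : ℤ → ℤ → ℤ) (X Y : Set ℤ) (l₁ l₂ u₁ u₂ : ℤ) : Prop :=
  ∃ x ∈ X, ∃ y ∈ Y, l₁ ≤ x ∧ x ≤ u₁ ∧ l₂ ≤ y ∧ y ≤ u₂ ∧ Agree f g b x y

variable {f g b : ℤ → ℤ → ℤ} {X Y : Set ℤ} {l₁ l₂ u₁ u₂ p₁ p₂ q₁ q₂ m₁ m₂ : ℤ}

/-- Exchange of the two coordinates. -/
def swapArgs (f : ℤ → ℤ → ℤ) : ℤ → ℤ → ℤ := fun x y => f y x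

/-- Point reflection. -/
def reflect (f : ℤ → ℤ → ℤ) : ℤ → ℤ → ℤ := fun x y => -f (-x) (-y)

theorem MonoSigns.swap (h : MonoSigns f g b) :
    MonoSigns (swapArgs g) (swapArgs f) (swapArgs b) where
  f_mono _ _ _ _ h₁ h₂ := h.g_mono _ _ _ _ h₂ h₁
  g_mono _ _ _ _ h₁ h₂ := h.f_mono _ _ _ _ h₂ h₁
  b_mono _ _ _ _ h₁ h₂ := h.b_mono _ _ _ _ h₂ h₁
  f_bound _ _ := h.g_bound _ _
  g_bound _ _ := h.f_bound _ _
  b_val _ _ := h.b_val _ _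

theorem MonoSigns.reflect (h : MonoSigns f g b) :
    MonoSigns (reflect f) (reflect g) (reflect b) where
  f_mono x y x' y' h₁ h₂ := by
    have := h.f_mono (-x') (-y') (-x) (-y) (by omega) (by omega)
    simp only [RootFinding.reflect]; omega
  g_mono x y x' y' h₁ h₂ := by
    have := h.g_mono (-x') (-y') (-x) (-y) (by omega) (by omega)
    simp only [RootFinding.reflect]; omega
  b_mono x y x' y' h₁ h₂ := by
    have := h.b_mono (-x') (-y') (-x) (-y) (by omega) (by omega)
    simp only [RootFinding.reflect]; omega
  f_bound x y := by
    have := h.f_bound (-x) (-y)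
    simp only [RootFinding.reflect]; omega
  g_bound x y := by
    have := h.g_bound (-x) (-y)
    simp only [RootFinding.reflect]; omega
  b_val x y := by
    have := h.b_val (-x) (-y)
    simp only [RootFinding.reflect]; omega

theorem Cert.swap (h : Cert f g b X Y l₁ l₂ u₁ u₂ p₁ p₂ q₁ q₂) :
    Cert (swapArgs g) (swapArgs f) (swapArgs b) Y X l₂ l₁ u₂ u₁ p₂ p₁ q₂ q₁ where
  mem₁ := h.mem₂
  mem₂ := h.mem₁
  le₁ := h.le₂
  le₂ := h.le₁
  top := by have := h.top; simp only [Top, swapArgs] at *; tauto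
  bot := by have := h.bot; simp only [Bot, swapArgs] at *; tauto

theorem reflect_reflect (f : ℤ → ℤ → ℤ) : reflect (reflect f) = f := by
  funext x y; simp [reflect]

theorem Cert.reflect (h : Cert f g b X Y l₁ l₂ u₁ u₂ p₁ p₂ q₁ q₂) :
    Cert (reflect f) (reflect g) (reflect b) {x | -x ∈ X} {y | -y ∈ Y}
      (-u₁) (-u₂) (-l₁) (-l₂) (-q₁) (-q₂) (-p₁) (-p₂) where
  mem₁ := by have := h.mem₁; simp only [Set.mem_ofPred_eq, neg_neg]; tauto
  mem₂ := by have := h.mem₂; simp only [Set.mem_ofPred_eq, neg_neg]; tauto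
  le₁ := by have := h.le₁; omega
  le₂ := by have := h.le₂; omega
  top := by have := h.bot; simp only [Top, Bot, RootFinding.reflect, neg_neg] at *; omega
  bot := by have := h.top; simp only [Top, Bot, RootFinding.reflect, neg_neg] at *; omega

theorem Cert.of_reflect (h : Cert (RootFinding.reflect f) (RootFinding.reflect g)
    (RootFinding.reflect b) {x | -x ∈ X} {y | -y ∈ Y} l₁ l₂ u₁ u₂ p₁ p₂ q₁ q₂) :
    Cert f g b X Y (-u₁) (-u₂) (-l₁) (-l₂) (-q₁) (-q₂) (-p₁) (-p₂) := by
  simpa [reflect_reflect] using h.reflect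

theorem HasAgree.of_swap
    (h : HasAgree (swapArgs g) (swapArgs f) (swapArgs b) Y X l₂ l₁ u₂ u₁) :
    HasAgree f g b X Y l₁ l₂ u₁ u₂ := by
  obtain ⟨x, hx, y, hy, a1, a2, a3, a4, h⟩ := h
  refine ⟨y, hy, x, hx, a3, a4, a1, a2, ?_⟩
  simp only [Agree, swapArgs] at *
  tauto

theorem HasAgree.of_reflect
    (h : HasAgree (reflect f) (reflect g) (reflect b) {x | -x ∈ X} {y | -y ∈ Y}
      (-u₁) (-u₂) (-l₁) (-l₂)) :
    HasAgree f g b X Y l₁ l₂ u₁ u₂ := by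
  obtain ⟨x, hx, y, hy, a1, a2, a3, a4, h⟩ := h
  refine ⟨-x, hx, -y, hy, by omega, by omega, by omega, by omega, ?_⟩
  simp only [Agree, reflect] at *
  omega

/-- A certificate point below height `m₂` is on the right edge, so `b = 1` at `(u₁, m₂)` and
agreement fails there only if `f` or `g` is negative. If `g < 0`, the upper corner drops to this
point; otherwise this point becomes the certificate point. After a drop, a lower certificate point
left above the line is on the left edge and is lowered to `(l₁, m₂)`, unless the signs agree there.
-/
theorem Cert.trim_top_snd (h : MonoSigns f g b) (hs : Cert f g b X Y l₁ l₂ u₁ u₂ p₁ p₂ q₁ q₂)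
    (hY : m₂ ∈ Y) (hm : l₂ ≤ m₂) (hm' : m₂ ≤ u₂) :
    HasAgree f g b X Y l₁ l₂ u₁ u₂ ∨
    (∃ q₂', Cert f g b X Y l₁ l₂ u₁ m₂ p₁ p₂ q₁ q₂') ∨
    (∃ p₂', m₂ ≤ p₂' ∧ Cert f g b X Y l₁ l₂ u₁ u₂ p₁ p₂' q₁ q₂) := by
  by_cases hp : m₂ ≤ p₂
  · exact .inr (.inr ⟨p₂, hp, hs⟩)
  obtain ⟨⟨x1, x2, x3, x4⟩, ⟨y1, y2, y3, y4⟩, ⟨a1, a3, a5, a7⟩, ⟨a2, a4, a6, a8⟩, ht, hb⟩ := hs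
  have hpu : p₁ = u₁ ∧ b p₁ p₂ = 1 ∧ 0 ≤ g p₁ p₂ ∧ f p₁ p₂ ≤ 0 ∧ g u₁ u₂ ≤ 0 := by
    rcases ht with ht | ht | ht
    · omega
    · omega
    · exact ht
  obtain ⟨rfl, hb1, hg1, hf1, hg2⟩ := hpu
  have hbr : b p₁ m₂ = 1 := by
    have := h.b_mono p₁ p₂ p₁ m₂ le_rfl (by omega)
    have := h.b_val p₁ m₂
    omega
  by_cases hg : 0 ≤ g p₁ m₂
  · by_cases hf : 0 ≤ f p₁ m₂
    · exact .inl ⟨p₁, x2, m₂, hY, a1, a3, hm, hm', .inl ⟨hf, hg, hbr⟩⟩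
    · exact .inr (.inr ⟨m₂, le_rfl, ⟨⟨x1, x2, x3, x4⟩, ⟨y1, y2, hY, y4⟩, ⟨a1, a3, a5, a7⟩,
        ⟨hm, hm', a6, a8⟩, .inr (.inr ⟨rfl, hbr, hg, by omega, hg2⟩), hb⟩⟩)
  · have htop : Top f g b p₁ m₂ p₁ p₂ := .inr (.inr ⟨rfl, hb1, hg1, hf1, by omega⟩)
    by_cases hq : q₂ ≤ m₂
    · exact .inr (.inl ⟨q₂, ⟨x1, x2, x3, x4⟩, ⟨y1, hY, y3, y4⟩, ⟨a1, a3, a5, a7⟩,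
        ⟨a2, by omega, a6, hq⟩, htop, hb⟩)
    have hql : q₁ = l₁ ∧ b q₁ q₂ = -1 ∧ g q₁ q₂ ≤ 0 ∧ 0 ≤ f q₁ q₂ ∧ 0 ≤ g l₁ l₂ := by
      rcases hb with hb | hb | hb
      · omega
      · omega
      · exact hb
    obtain ⟨rfl, hb2, hg3, hf3, hg4⟩ := hql
    have hbr' : b q₁ m₂ = -1 := by
      have := h.b_mono q₁ m₂ q₁ q₂ le_rfl (by omega)
      have := h.b_val q₁ m₂
      omega
    have hgr := h.g_mono q₁ m₂ p₁ m₂ a7 le_rfl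
    by_cases hf : f q₁ m₂ ≤ 0
    · exact .inl ⟨q₁, x1, m₂, hY, a5, a7, hm, hm', .inr ⟨hf, by omega, hbr'⟩⟩
    · exact .inr (.inl ⟨m₂, ⟨x1, x2, x3, x4⟩, ⟨y1, hY, y3, hY⟩, ⟨a1, a3, a5, a7⟩,
        ⟨a2, by omega, hm, le_rfl⟩, htop,
        .inr (.inr ⟨rfl, hbr', by omega, by omega, hg4⟩)⟩)

theorem Cert.trim_bot_snd (h : MonoSigns f g b) (hs : Cert f g b X Y l₁ l₂ u₁ u₂ p₁ p₂ q₁ q₂)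
    (hY : m₂ ∈ Y) (hm : l₂ ≤ m₂) (hm' : m₂ ≤ u₂) :
    HasAgree f g b X Y l₁ l₂ u₁ u₂ ∨
    (∃ p₂', Cert f g b X Y l₁ m₂ u₁ u₂ p₁ p₂' q₁ q₂) ∨
    (∃ q₂', q₂' ≤ m₂ ∧ Cert f g b X Y l₁ l₂ u₁ u₂ p₁ p₂ q₁ q₂') := by
  rcases hs.reflect.trim_top_snd h.reflect (m₂ := -m₂) (by simpa using hY) (by omega) (by omega)
    with H | ⟨r, H⟩ | ⟨r, hr, H⟩
  · exact .inl H.of_reflect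
  · exact .inr (.inl ⟨-r, by simpa using H.of_reflect⟩)
  · exact .inr (.inr ⟨-r, by omega, by simpa using H.of_reflect⟩)

/-- The second coordinates of the certificates can be moved to the far sides of the line at height
`m₂`, unless the height of the box can be reduced. -/
theorem Cert.trim_snd (h : MonoSigns f g b) (hs : Cert f g b X Y l₁ l₂ u₁ u₂ p₁ p₂ q₁ q₂)
    (hY : m₂ ∈ Y) (hm : l₂ ≤ m₂) (hm' : m₂ ≤ u₂) :
    HasAgree f g b X Y l₁ l₂ u₁ u₂ ∨
    (∃ p₂' q₂', Cert f g b X Y l₁ l₂ u₁ m₂ p₁ p₂' q₁ q₂') ∨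
    (∃ p₂' q₂', Cert f g b X Y l₁ m₂ u₁ u₂ p₁ p₂' q₁ q₂') ∨
    (∃ p₂' q₂', q₂' ≤ m₂ ∧ m₂ ≤ p₂' ∧ Cert f g b X Y l₁ l₂ u₁ u₂ p₁ p₂' q₁ q₂') := by
  rcases hs.trim_top_snd h hY hm hm' with H | ⟨r, H⟩ | ⟨r, hr, H⟩
  · exact .inl H
  · exact .inr (.inl ⟨_, _, H⟩)
  rcases H.trim_bot_snd h hY hm hm' with H | ⟨r', H⟩ | ⟨r', hr', H⟩
  · exact .inl H
  · exact .inr (.inr (.inl ⟨_, _, H⟩))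
  · exact .inr (.inr (.inr ⟨_, _, hr', hr, H⟩))

theorem Cert.trim_fst (h : MonoSigns f g b) (hs : Cert f g b X Y l₁ l₂ u₁ u₂ p₁ p₂ q₁ q₂)
    (hX : m₁ ∈ X) (hm : l₁ ≤ m₁) (hm' : m₁ ≤ u₁) :
    HasAgree f g b X Y l₁ l₂ u₁ u₂ ∨
    (∃ p₁' q₁', Cert f g b X Y l₁ l₂ m₁ u₂ p₁' p₂ q₁' q₂) ∨
    (∃ p₁' q₁', Cert f g b X Y m₁ l₂ u₁ u₂ p₁' p₂ q₁' q₂) ∨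
    (∃ p₁' q₁', q₁' ≤ m₁ ∧ m₁ ≤ p₁' ∧ Cert f g b X Y l₁ l₂ u₁ u₂ p₁' p₂ q₁' q₂) := by
  rcases hs.swap.trim_snd h.swap hX hm hm' with H | ⟨r, r', H⟩ | ⟨r, r', H⟩ | ⟨r, r', h1, h2, H⟩
  · exact .inl H.of_swap
  · exact .inr (.inl ⟨_, _, H.swap⟩)
  · exact .inr (.inr (.inl ⟨_, _, H.swap⟩))
  · exact .inr (.inr (.inr ⟨_, _, h1, h2, H.swap⟩))

/-- A box inside `[(l₁, l₂), (u₁, u₂)]` and on one side of one of the lines through `(m₁, m₂)`. -/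
def Smaller (l₁ l₂ u₁ u₂ m₁ m₂ l₁' l₂' u₁' u₂' : ℤ) : Prop :=
  l₁ ≤ l₁' ∧ l₂ ≤ l₂' ∧ u₁' ≤ u₁ ∧ u₂' ≤ u₂ ∧ (u₁' ≤ m₁ ∨ m₁ ≤ l₁' ∨ u₂' ≤ m₂ ∨ m₂ ≤ l₂')

/-- Two negative signs at `(m₁, m₂)` make it the new upper corner. With mixed signs it is the
certificate point of an edge running to the line of an old side; the old certificate gives the sign
at the far end, because `(p₁, p₂)` lies beyond `(m₁, m₂)`. -/
theorem Cert.split_of_pos (h : MonoSigns f g b) (hs : Cert f g b X Y l₁ l₂ u₁ u₂ p₁ p₂ q₁ q₂)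
    (hX : m₁ ∈ X) (hY : m₂ ∈ Y) (hq₁ : q₁ ≤ m₁) (hq₂ : q₂ ≤ m₂) (hp₁ : m₁ ≤ p₁) (hp₂ : m₂ ≤ p₂)
    (hb : b m₁ m₂ = 1) :
    HasAgree f g b X Y l₁ l₂ u₁ u₂ ∨
    ∃ u₁' u₂' p₁' p₂', Smaller l₁ l₂ u₁ u₂ m₁ m₂ l₁ l₂ u₁' u₂' ∧
      Cert f g b X Y l₁ l₂ u₁' u₂' p₁' p₂' q₁ q₂ := by
  obtain ⟨⟨x1, x2, x3, x4⟩, ⟨y1, y2, y3, y4⟩, ⟨a1, a3, a5, a7⟩, ⟨a2, a4, a6, a8⟩, ht, hbot⟩ := hs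
  rcases lt_or_ge (f m₁ m₂) 0 with hf | hf <;> rcases lt_or_ge (g m₁ m₂) 0 with hg | hg
  · exact .inr ⟨m₁, m₂, m₁, m₂, by unfold Smaller; omega, ⟨x1, hX, hX, x4⟩, ⟨y1, hY, hY, y4⟩,
      by omega, by omega, .inl ⟨rfl, rfl, hf.le, hg.le⟩, hbot⟩
  · have hgu : g m₁ u₂ ≤ 0 := by
      have := h.g_mono m₁ u₂ u₁ u₂ (by omega) le_rfl
      have := h.g_mono m₁ u₂ p₁ u₂ (by omega) le_rfl
      rcases ht with ht | ⟨rfl, ht⟩ | ht <;> omega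
    exact .inr ⟨m₁, u₂, m₁, m₂, by unfold Smaller; omega, ⟨x1, hX, hX, x4⟩, ⟨y1, y2, hY, y4⟩,
      by omega, by omega, .inr (.inr ⟨rfl, hb, hg, hf.le, hgu⟩), hbot⟩
  · have hfu : f u₁ m₂ ≤ 0 := by
      have := h.f_mono u₁ m₂ u₁ u₂ le_rfl (by omega)
      have := h.f_mono u₁ m₂ u₁ p₂ le_rfl (by omega)
      rcases ht with ht | ht | ⟨rfl, ht⟩ <;> omega
    exact .inr ⟨u₁, m₂, m₁, m₂, by unfold Smaller; omega, ⟨x1, x2, hX, x4⟩, ⟨y1, hY, hY, y4⟩,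
      by omega, by omega, .inr (.inl ⟨rfl, hb, hf, hg.le, hfu⟩), hbot⟩
  · exact .inl ⟨m₁, hX, m₂, hY, by omega, by omega, by omega, by omega, .inl ⟨hf, hg, hb⟩⟩

/-- Trimming in both directions puts the certificate points on opposite sides of both lines, as
`split_of_pos` requires. Point reflection covers `b m₁ m₂ = -1`. -/
theorem Cert.split (h : MonoSigns f g b) (hs : Cert f g b X Y l₁ l₂ u₁ u₂ p₁ p₂ q₁ q₂)
    (hX : m₁ ∈ X) (hY : m₂ ∈ Y)
    (h₁ : l₁ ≤ m₁ ∧ m₁ ≤ u₁) (h₂ : l₂ ≤ m₂ ∧ m₂ ≤ u₂) :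
    HasAgree f g b X Y l₁ l₂ u₁ u₂ ∨
    ∃ l₁' l₂' u₁' u₂' p₁' p₂' q₁' q₂', Smaller l₁ l₂ u₁ u₂ m₁ m₂ l₁' l₂' u₁' u₂' ∧
      Cert f g b X Y l₁' l₂' u₁' u₂' p₁' p₂' q₁' q₂' := by
  have hmem₁ := hs.mem₁
  have hmem₂ := hs.mem₂
  rcases hs.trim_snd h hY h₂.1 h₂.2 with H | ⟨r, r', H⟩ | ⟨r, r', H⟩ | ⟨r, r', hr', hr, H⟩
  · exact .inl H
  · exact .inr ⟨_, _, _, _, _, _, _, _, by unfold Smaller; omega, H⟩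
  · exact .inr ⟨_, _, _, _, _, _, _, _, by unfold Smaller; omega, H⟩
  rcases H.trim_fst h hX h₁.1 h₁.2 with H | ⟨t, t', H⟩ | ⟨t, t', H⟩ | ⟨t, t', ht', ht, H⟩
  · exact .inl H
  · exact .inr ⟨_, _, _, _, _, _, _, _, by unfold Smaller; omega, H⟩
  · exact .inr ⟨_, _, _, _, _, _, _, _, by unfold Smaller; omega, H⟩
  rcases h.b_val m₁ m₂ with hb | hb
  · rcases H.reflect.split_of_pos h.reflect (m₁ := -m₁) (m₂ := -m₂) (by simpa using hX)
      (by simpa using hY) (by omega) (by omega) (by omega) (by omega) (by simp [RootFinding.reflect, hb])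
      with H | ⟨v, w, v', w', hS, H⟩
    · exact .inl H.of_reflect
    · refine .inr ⟨_, _, _, _, _, _, _, _, ?_, H.of_reflect⟩
      unfold Smaller at *
      omega
  · rcases H.split_of_pos h hX hY ht' hr' ht hr hb with H | ⟨v, w, v', w', hS, H⟩
    · exact .inl H
    · exact .inr ⟨_, _, _, _, _, _, _, _, hS, H⟩

/-- If the box has width at most `1`, its height can be reduced. -/
theorem Cert.split_thin (h : MonoSigns f g b) (hs : Cert f g b X Y l₁ l₂ u₁ u₂ p₁ p₂ q₁ q₂)
    (hY : m₂ ∈ Y) (h₁ : u₁ ≤ l₁ + 1) (h₂ : l₂ ≤ m₂ ∧ m₂ ≤ u₂) :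
    HasAgree f g b X Y l₁ l₂ u₁ u₂ ∨
    ∃ l₁' l₂' u₁' u₂' p₁' p₂' q₁' q₂', l₁ ≤ l₁' ∧ u₁' ≤ u₁ ∧
      (l₂' = l₂ ∧ u₂' = m₂ ∨ l₂' = m₂ ∧ u₂' = u₂) ∧
      Cert f g b X Y l₁' l₂' u₁' u₂' p₁' p₂' q₁' q₂' := by
  rcases hs.trim_snd h hY h₂.1 h₂.2 with H | ⟨r, r', H⟩ | ⟨r, r', H⟩ | ⟨r, r', hr', hr, H⟩
  · exact .inl H
  · exact .inr ⟨_, _, _, _, _, _, _, _, le_rfl, le_rfl, .inl ⟨rfl, rfl⟩, H⟩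
  · exact .inr ⟨_, _, _, _, _, _, _, _, le_rfl, le_rfl, .inr ⟨rfl, rfl⟩, H⟩
  obtain ⟨⟨x1, x2, x3, x4⟩, ⟨y1, y2, y3, y4⟩, ⟨a1, a3, a5, a7⟩, ⟨a2, a4, a6, a8⟩, ht, hbot⟩ := H
  have hf0 : 0 ≤ f l₁ m₂ := by
    have := h.f_mono l₁ l₂ l₁ m₂ le_rfl (by omega)
    have := h.f_mono l₁ r' l₁ m₂ le_rfl (by omega)
    rcases hbot with hb | hb | ⟨rfl, hb⟩ <;> omega
  have hf1 : f u₁ m₂ ≤ 0 := by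
    have := h.f_mono u₁ m₂ u₁ u₂ le_rfl (by omega)
    have := h.f_mono u₁ m₂ u₁ r le_rfl (by omega)
    rcases ht with ht | ht | ⟨rfl, ht⟩ <;> omega
  rcases h.b_val l₁ m₂ with hb0 | hb0
  · rcases h.b_val u₁ m₂ with hb1 | hb1
    · rcases lt_or_ge 0 (g u₁ m₂) with hg | hg
      · refine .inr ⟨l₁, m₂, u₁, u₂, p₁, r, u₁, m₂, le_rfl, le_rfl, .inr ⟨rfl, rfl⟩,
          ⟨x1, x2, x3, x2⟩, ⟨hY, y2, y3, hY⟩, by omega, by omega, ht,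
          .inr (.inl ⟨rfl, hb1, hf1, hg.le, hf0⟩)⟩
      · exact .inl ⟨u₁, x2, m₂, hY, by omega, by omega, by omega, by omega, .inr ⟨hf1, hg, hb1⟩⟩
    -- Here `b` changes sign between the two ends. As `f` drops by at most one from `f l₁ m₂ ≥ 0` to
    -- `f u₁ m₂ ≤ 0`, it vanishes at one of them.
    · have hd := h.f_mono l₁ m₂ u₁ m₂ (by omega) le_rfl
      have hbd := h.f_bound l₁ m₂
      by_cases hfz : f l₁ m₂ = 0
      · rcases lt_or_ge 0 (g l₁ m₂) with hg | hg
        · refine .inr ⟨l₁, m₂, u₁, u₂, p₁, r, l₁, m₂, le_rfl, le_rfl, .inr ⟨rfl, rfl⟩,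
            ⟨x1, x2, x3, x1⟩, ⟨hY, y2, y3, hY⟩, by omega, by omega, ht,
            .inl ⟨rfl, rfl, hf0, hg.le⟩⟩
        · exact .inl ⟨l₁, x1, m₂, hY, by omega, by omega, by omega, by omega,
            .inr ⟨hfz.le, hg, hb0⟩⟩
      · have hfz' : f u₁ m₂ = 0 := by omega
        rcases lt_or_ge (g u₁ m₂) 0 with hg | hg
        · refine .inr ⟨l₁, l₂, u₁, m₂, u₁, m₂, q₁, r', le_rfl, le_rfl, .inl ⟨rfl, rfl⟩,
            ⟨x1, x2, x2, x4⟩, ⟨y1, hY, hY, y4⟩, by omega, by omega,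
            .inl ⟨rfl, rfl, hf1, hg.le⟩, hbot⟩
        · exact .inl ⟨u₁, x2, m₂, hY, by omega, by omega, by omega, by omega,
            .inl ⟨hfz'.ge, hg, hb1⟩⟩
  · rcases lt_or_ge (g l₁ m₂) 0 with hg | hg
    · refine .inr ⟨l₁, l₂, u₁, m₂, l₁, m₂, q₁, r', le_rfl, le_rfl, .inl ⟨rfl, rfl⟩,
        ⟨x1, x2, x1, x4⟩, ⟨y1, hY, hY, y4⟩, by omega, by omega,
        .inr (.inl ⟨rfl, hb0, hf0, hg.le, hf1⟩), hbot⟩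
    · exact .inl ⟨l₁, x1, m₂, hY, by omega, by omega, by omega, by omega, .inl ⟨hf0, hg, hb0⟩⟩

theorem Top.corners (ht : Top f g b u₁ u₂ p₁ p₂) (hp₁ : p₁ = l₁ ∨ p₁ = u₁)
    (hp₂ : p₂ = l₂ ∨ p₂ = u₂) :
    (f u₁ u₂ ≤ 0 ∧ g u₁ u₂ ≤ 0) ∨
    (b l₁ u₂ = 1 ∧ 0 ≤ f l₁ u₂ ∧ g l₁ u₂ ≤ 0 ∧ f u₁ u₂ ≤ 0) ∨
    (b u₁ l₂ = 1 ∧ 0 ≤ g u₁ l₂ ∧ f u₁ l₂ ≤ 0 ∧ g u₁ u₂ ≤ 0) := by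
  rcases ht with ht | ⟨rfl, ht⟩ | ⟨rfl, ht⟩
  · exact .inl ht.2.2
  · rcases hp₁ with rfl | rfl
    · exact .inr (.inl ht)
    · exact .inl (by omega)
  · rcases hp₂ with rfl | rfl
    · exact .inr (.inr ht)
    · exact .inl (by omega)

theorem Bot.corners (hb : Bot f g b l₁ l₂ q₁ q₂) (hq₁ : q₁ = l₁ ∨ q₁ = u₁)
    (hq₂ : q₂ = l₂ ∨ q₂ = u₂) :
    (0 ≤ f l₁ l₂ ∧ 0 ≤ g l₁ l₂) ∨
    (b u₁ l₂ = -1 ∧ f u₁ l₂ ≤ 0 ∧ 0 ≤ g u₁ l₂ ∧ 0 ≤ f l₁ l₂) ∨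
    (b l₁ u₂ = -1 ∧ g l₁ u₂ ≤ 0 ∧ 0 ≤ f l₁ u₂ ∧ 0 ≤ g l₁ l₂) := by
  rcases hb with ht | ⟨rfl, ht⟩ | ⟨rfl, ht⟩
  · exact .inl ht.2.2
  · rcases hq₁ with rfl | rfl
    · exact .inl (by omega)
    · exact .inr (.inl ht)
  · rcases hq₂ with rfl | rfl
    · exact .inl (by omega)
    · exact .inr (.inr ht)

-- All certificate points are now corners, which leaves a finite check on the signs at four points.
set_option maxHeartbeats 1000000 in
theorem Cert.hasAgree (h : MonoSigns f g b) (hs : Cert f g b X Y l₁ l₂ u₁ u₂ p₁ p₂ q₁ q₂)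
    (h₁ : u₁ ≤ l₁ + 1) (h₂ : u₂ ≤ l₂ + 1) : HasAgree f g b X Y l₁ l₂ u₁ u₂ := by
  obtain ⟨⟨x1, x2, x3, x4⟩, ⟨y1, y2, y3, y4⟩, ⟨a1, a3, a5, a7⟩, ⟨a2, a4, a6, a8⟩, ht, hb⟩ := hs
  have hl₁ : l₁ ≤ u₁ := by omega
  have hl₂ : l₂ ≤ u₂ := by omega
  replace ht := ht.corners (l₁ := l₁) (l₂ := l₂) (by omega) (by omega)
  replace hb := hb.corners (u₁ := u₁) (u₂ := u₂) (by omega) (by omega)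
  by_contra hn
  have n00 : ¬Agree f g b l₁ l₂ := fun H => hn ⟨_, x1, _, y1, le_rfl, hl₁, le_rfl, hl₂, H⟩
  have n10 : ¬Agree f g b u₁ l₂ := fun H => hn ⟨_, x2, _, y1, hl₁, le_rfl, le_rfl, hl₂, H⟩
  have n01 : ¬Agree f g b l₁ u₂ := fun H => hn ⟨_, x1, _, y2, le_rfl, hl₁, hl₂, le_rfl, H⟩
  have n11 : ¬Agree f g b u₁ u₂ := fun H => hn ⟨_, x2, _, y2, hl₁, le_rfl, hl₂, le_rfl, H⟩
  have f1 := h.f_mono l₁ l₂ u₁ l₂ hl₁ le_rfl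
  have f2 := h.f_mono l₁ l₂ l₁ u₂ le_rfl hl₂
  have f3 := h.f_mono u₁ l₂ u₁ u₂ le_rfl hl₂
  have f4 := h.f_mono l₁ u₂ u₁ u₂ hl₁ le_rfl
  have g1 := h.g_mono l₁ l₂ u₁ l₂ hl₁ le_rfl
  have g2 := h.g_mono l₁ l₂ l₁ u₂ le_rfl hl₂
  have g3 := h.g_mono u₁ l₂ u₁ u₂ le_rfl hl₂
  have g4 := h.g_mono l₁ u₂ u₁ u₂ hl₁ le_rfl
  have b1 := h.b_mono l₁ l₂ u₁ l₂ hl₁ le_rfl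
  have b2 := h.b_mono l₁ l₂ l₁ u₂ le_rfl hl₂
  have b3 := h.b_mono u₁ l₂ u₁ u₂ le_rfl hl₂
  have b4 := h.b_mono l₁ u₂ u₁ u₂ hl₁ le_rfl
  have v00 := h.b_val l₁ l₂
  have v10 := h.b_val u₁ l₂
  have v01 := h.b_val l₁ u₂
  have v11 := h.b_val u₁ u₂
  simp only [Agree] at n00 n10 n01 n11
  clear hn h x1 x2 x3 x4 y1 y2 y3 y4 a1 a2 a3 a4 a5 a6 a7 a8
  generalize f l₁ l₂ = f00, f u₁ l₂ = f10, f l₁ u₂ = f01, f u₁ u₂ = f11, g l₁ l₂ = g00,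
    g u₁ l₂ = g10, g l₁ u₂ = g01, g u₁ u₂ = g11, b l₁ l₂ = b00, b u₁ l₂ = b10,
    b l₁ u₂ = b01, b u₁ u₂ = b11 at *
  rcases v00 with rfl | rfl <;> rcases v01 with rfl | rfl <;> rcases v10 with rfl | rfl <;>
    rcases v11 with rfl | rfl <;> omega

/-! ### Planar problem: counting queries. -/

/-- A box `[(l₁, l₂), (u₁, u₂)]` with two points `p`, `q`. -/
structure Cell where
  (l₁ l₂ u₁ u₂ p₁ p₂ q₁ q₂ : ℤ)

namespace Cell

/-- The points `p` and `q` of the cell belong to certificates at its corners. -/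
def IsCert (f g b : ℤ → ℤ → ℤ) (X Y : Set ℤ) (s : Cell) : Prop :=
  Cert f g b X Y s.l₁ s.l₂ s.u₁ s.u₂ s.p₁ s.p₂ s.q₁ s.q₂

/-- The sides of the cell have lengths at most `2 ^ k₁` and `2 ^ k₂`. -/
def Fits (s : Cell) (k₁ k₂ : ℕ) : Prop :=
  s.u₁ ≤ s.l₁ + 2 ^ k₁ ∧ s.u₂ ≤ s.l₂ + 2 ^ k₂

/-- A subcell one of whose sides is halved. -/
def Half (s : Cell) (k₁ k₂ : ℕ) (s' : Cell) : Prop :=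
  s.l₁ ≤ s'.l₁ ∧ s.l₂ ≤ s'.l₂ ∧ s'.u₁ ≤ s.u₁ ∧ s'.u₂ ≤ s.u₂ ∧
    ∃ k₁' k₂', k₁' + k₂' + 1 = k₁ + k₂ ∧ s'.Fits k₁' k₂'

/-- A side of length one need not shrink under `split`, as its midpoint may be an endpoint; hence
the separate treatment of thin boxes. -/
theorem exists_half (h : MonoSigns f g b) {s : Cell} {k₁ k₂ : ℕ} (hk : s.Fits k₁ k₂)
    (hs : s.IsCert f g b X Y) (hX : s.l₁ + (s.u₁ - s.l₁) / 2 ∈ X)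
    (hY : s.l₂ + (s.u₂ - s.l₂) / 2 ∈ Y) :
    HasAgree f g b X Y s.l₁ s.l₂ s.u₁ s.u₂ ∨ ∃ s', s.Half k₁ k₂ s' ∧ s'.IsCert f g b X Y := by
  obtain ⟨l₁, l₂, u₁, u₂, p₁, p₂, q₁, q₂⟩ := s
  simp only [Fits, IsCert, Half] at *
  have hl₁ := hs.le₁
  have hl₂ := hs.le₂
  rcases k₁ with _ | k₁ <;> rcases k₂ with _ | k₂
  · exact .inl (hs.hasAgree h (by omega) (by omega))
  · rcases hs.split_thin h hY (by omega) (by omega) with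
      H | ⟨l₁', l₂', u₁', u₂', p₁', p₂', q₁', q₂', h1, h2, h3, H⟩
    · exact .inl H
    · exact .inr ⟨⟨l₁', l₂', u₁', u₂', p₁', p₂', q₁', q₂'⟩, ⟨h1, by dsimp only; omega, h2,
        by dsimp only; omega, 0, k₂, by omega, by dsimp only; omega, by dsimp only; omega⟩, H⟩
  · rcases hs.swap.split_thin h.swap hX (by omega) (by omega) with
      H | ⟨l₁', l₂', u₁', u₂', p₁', p₂', q₁', q₂', h1, h2, h3, H⟩
    · exact .inl H.of_swap
    · exact .inr ⟨⟨l₂', l₁', u₂', u₁', p₂', p₁', q₂', q₁'⟩, ⟨by dsimp only; omega, h1,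
        by dsimp only; omega, h2, k₁, 0, by omega, by dsimp only; omega, by dsimp only; omega⟩,
        H.swap⟩
  · rcases hs.split h hX hY (by omega) (by omega) with
      H | ⟨l₁', l₂', u₁', u₂', p₁', p₂', q₁', q₂', ⟨h1, h2, h3, h4, h5⟩, H⟩
    · exact .inl H
    · refine .inr ⟨⟨l₁', l₂', u₁', u₂', p₁', p₂', q₁', q₂'⟩, ⟨h1, h2, h3, h4, ?_⟩, H⟩
      dsimp only
      by_cases h6 : u₁' ≤ l₁' + 2 ^ k₁
      · exact ⟨k₁, k₂ + 1, by omega, h6, by omega⟩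
      · exact ⟨k₁ + 1, k₂, by omega, by omega, by omega⟩

end Cell

/-- The answers of `h` form a planar monotone sign function. -/
def PlanarMono (h : ℤ × ℤ → ℤ × ℤ × ℤ) : Prop :=
  MonoSigns (fun x y => (h (x, y)).1) (fun x y => (h (x, y)).2.1) (fun x y => (h (x, y)).2.2)

/-- The three signs of the answer of `h` at `z` agree weakly. -/
def AgreeAt (h : ℤ × ℤ → ℤ × ℤ × ℤ) (z : ℤ × ℤ) : Prop :=
  Agree (fun x y => (h (x, y)).1) (fun x y => (h (x, y)).2.1) (fun x y => (h (x, y)).2.2) z.1 z.2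

/-- `Cell.IsCert` for the three components of `h`. -/
def Cell.CertFor (h : ℤ × ℤ → ℤ × ℤ × ℤ) (X Y : Set ℤ) (s : Cell) : Prop :=
  s.IsCert (fun x y => (h (x, y)).1) (fun x y => (h (x, y)).2.1) (fun x y => (h (x, y)).2.2) X Y

theorem AgreeAt.congr {h h' : ℤ × ℤ → ℤ × ℤ × ℤ} {z : ℤ × ℤ} (e : h z = h' z)
    (H : AgreeAt h z) : AgreeAt h' z := by
  simpa only [AgreeAt, Agree, Prod.mk.eta, e] using H

theorem Cell.CertFor.congr {h h' : ℤ × ℤ → ℤ × ℤ × ℤ} {s : Cell}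
    (e : ∀ x ∈ X, ∀ y ∈ Y, h (x, y) = h' (x, y)) (H : s.CertFor h X Y) : s.CertFor h' X Y := by
  obtain ⟨⟨x1, x2, x3, x4⟩, ⟨y1, y2, y3, y4⟩, hl₁, hl₂, ht, hb⟩ := H
  refine ⟨⟨x1, x2, x3, x4⟩, ⟨y1, y2, y3, y4⟩, hl₁, hl₂, ?_, ?_⟩
  · simpa only [Top, e _ x2 _ y2, e _ x3 _ y3] using ht
  · simpa only [Bot, e _ x1 _ y1, e _ x4 _ y4] using hb

theorem Cell.CertFor.restrict {h : ℤ × ℤ → ℤ × ℤ × ℤ} {s : Cell} {X' Y' : Set ℤ}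
    (H : s.CertFor h X Y) (hX : s.l₁ ∈ X' ∧ s.u₁ ∈ X' ∧ s.p₁ ∈ X' ∧ s.q₁ ∈ X')
    (hY : s.l₂ ∈ Y' ∧ s.u₂ ∈ Y' ∧ s.p₂ ∈ Y' ∧ s.q₂ ∈ Y') : s.CertFor h X' Y' :=
  ⟨hX, hY, H.le₁, H.le₂, H.top, H.bot⟩

/-- The outcome of one round: a point with agreeing signs, or a smaller cell. -/
def RoundGoal (s : Cell) (k₁ k₂ : ℕ) (X Y : Set ℤ) (h : ℤ × ℤ → ℤ × ℤ × ℤ) :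
    (ℤ × ℤ) ⊕ Cell → Prop
  | .inl z => z.1 ∈ X ∧ z.2 ∈ Y ∧ (s.l₁ ≤ z.1 ∧ z.1 ≤ s.u₁ ∧ s.l₂ ≤ z.2 ∧ z.2 ≤ s.u₂) ∧ AgreeAt h z
  | .inr s' => s.Half k₁ k₂ s' ∧ s'.CertFor h X Y

/-- One step inspects and produces only points of a five by five grid; this is what the sets `X` and
`Y` in `Cert` keep track of. The values on this grid determine which outcomes are correct. -/
theorem solves_round (s : Cell) {k₁ k₂ : ℕ} (hk : s.Fits k₁ k₂) :
    Solves 25 (fun h => PlanarMono h ∧ s.CertFor h .univ .univ)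
      (fun h r => RoundGoal s k₁ k₂ .univ .univ h r) := by
  set X : Finset ℤ := {s.l₁, s.u₁, s.p₁, s.q₁, s.l₁ + (s.u₁ - s.l₁) / 2} with hX
  set Y : Finset ℤ := {s.l₂, s.u₂, s.p₂, s.q₂, s.l₂ + (s.u₂ - s.l₂) / 2} with hY
  have : Nonempty ((ℤ × ℤ) ⊕ Cell) := ⟨.inl 0⟩
  have key : Solves 25 (fun h => PlanarMono h ∧ s.CertFor h .univ .univ)
      (fun h r => RoundGoal s k₁ k₂ X Y h r) := by
    refine Solves.of_determined (X ×ˢ Y) ?_ ?_ ?_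
    · rw [Finset.card_product]
      exact Nat.mul_le_mul Finset.card_le_five Finset.card_le_five
    · rintro h ⟨hm, hs⟩
      rcases Cell.exists_half (X := X) (Y := Y) hm hk (hs.restrict (by simp [hX]) (by simp [hY]))
        (by simp [hX]) (by simp [hY]) with ⟨x, hx, y, hy, h1, h2, h3, h4, H⟩ | ⟨s', hs', H⟩
      · exact ⟨.inl (x, y), hx, hy, ⟨h1, h2, h3, h4⟩, H⟩
      · exact ⟨.inr s', hs', H⟩
    · intro h h' r _ _ e hr
      rcases r with z | s'
      · obtain ⟨hx, hy, hz, H⟩ := hr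
        exact ⟨hx, hy, hz, H.congr (e z (Finset.mem_product.2 ⟨hx, hy⟩))⟩
      · exact ⟨hr.1, hr.2.congr fun x hx y hy => e (x, y) (Finset.mem_product.2 ⟨hx, hy⟩)⟩
  refine key.mono le_rfl (fun _ h => h) ?_
  rintro h (z | s') _ hr
  · exact ⟨trivial, trivial, hr.2.2⟩
  · exact ⟨hr.1, hr.2.restrict (by simp) (by simp)⟩

/-- Agreeing signs of a planar monotone sign function are found in logarithmically many
queries. -/
theorem solves_planar_of_cert (n : ℕ) (s : Cell) {k₁ k₂ : ℕ} (hn : k₁ + k₂ = n)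
    (hk : s.Fits k₁ k₂) :
    Solves (25 * (n + 1)) (fun h => PlanarMono h ∧ s.CertFor h .univ .univ)
      (fun h z => (s.l₁ ≤ z.1 ∧ z.1 ≤ s.u₁ ∧ s.l₂ ≤ z.2 ∧ z.2 ≤ s.u₂) ∧ AgreeAt h z) := by
  induction n generalizing s k₁ k₂ with
  | zero =>
    refine ((solves_round s hk).bind (m := 0) fun r => ?_).mono le_rfl (fun _ h => h)
      fun _ _ _ h => h
    rcases r with z | s'
    · exact .pure z fun h hh => hh.2.2.2
    · refine .pure 0 fun h hh => ?_
      obtain ⟨_, _, _, _, k₁', k₂', hk', _⟩ := hh.2.1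
      omega
  | succ n ih =>
    rw [Nat.mul_succ, Nat.add_comm]
    refine (solves_round s hk).bind fun r => ?_
    rcases r with z | s'
    · exact .pure z fun h hh => hh.2.2.2
    · by_cases hs' : s.Half k₁ k₂ s'
      · obtain ⟨h1, h2, h3, h4, k₁', k₂', hk', hf⟩ := hs'
        refine (ih s' (by omega) hf).mono le_rfl (fun h hh => ⟨hh.1.1, hh.2.2⟩) ?_
        rintro h z - ⟨hz, H⟩
        exact ⟨by omega, H⟩
      · exact .pure 0 fun h hh => (hs' hh.2.1).elim

theorem solves_planar (k : ℕ) {l₁ l₂ u₁ u₂ : ℤ} (h₁ : l₁ ≤ u₁) (h₂ : l₂ ≤ u₂)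
    (hk₁ : u₁ ≤ l₁ + 2 ^ k) (hk₂ : u₂ ≤ l₂ + 2 ^ k) :
    Solves (25 * (2 * k + 1)) (fun h => PlanarMono h ∧
        (0 ≤ (h (l₁, l₂)).1 ∧ 0 ≤ (h (l₁, l₂)).2.1) ∧ (h (u₁, u₂)).1 ≤ 0 ∧ (h (u₁, u₂)).2.1 ≤ 0)
      (fun h z => (l₁ ≤ z.1 ∧ z.1 ≤ u₁ ∧ l₂ ≤ z.2 ∧ z.2 ≤ u₂) ∧ AgreeAt h z) := by
  refine (solves_planar_of_cert (2 * k) ⟨l₁, l₂, u₁, u₂, u₁, u₂, l₁, l₂⟩ (two_mul k).symm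
    ⟨hk₁, hk₂⟩).mono le_rfl ?_ fun _ _ _ h => h
  rintro h ⟨hm, hl, hu⟩
  exact ⟨hm, ⟨by simp, by simp, by dsimp only; omega, by dsimp only; omega, .inl ⟨rfl, rfl, hu⟩,
    .inl ⟨rfl, rfl, hl⟩⟩⟩

end RootFinding

/-! ### Slice problems and consistent records of their solutions. -/

namespace RootFinding
variable {ι : Type}

/-- In every box that is degenerate outside `S` and has sides at most `2 ^ K`, with its corners
moved inwards in the directions of `S` by the monotone function `g`, one can find with `n`
evaluations a point `x` that `g` moves up in the directions of `S`, with `c ≤ g x t`, or down, with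
`g x t < c`. -/
def SliceSolvable (S : Finset ι) (K n : ℕ) : Prop :=
  ∀ (t : ι) (c : ℤ) (l u : ι → ℤ), l ≤ u → (∀ i ∉ S, l i = u i) → (∀ i, u i ≤ l i + 2 ^ K) →
    Solves n (fun g : (ι → ℤ) → (ι → ℤ) => Monotone g ∧ ∀ i ∈ S, l i ≤ g l i ∧ g u i ≤ u i)
      (fun g x => l ≤ x ∧ x ≤ u ∧
        ((∀ i ∈ S, x i ≤ g x i) ∧ c ≤ g x t ∨ (∀ i ∈ S, g x i ≤ x i) ∧ g x t < c))

/-- The point `l` is right whatever the query returns; the bound `1` matches the zeroth power in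
`sliceSolvable_of_card`. -/
theorem SliceSolvable.empty (K : ℕ) : SliceSolvable (∅ : Finset ι) K 1 := by
  intro t c l u hlu _ _
  exact .ask l fun y => .pure l fun g _ => ⟨le_rfl, hlu, by simp [le_or_gt]⟩

variable [DecidableEq ι]

/-- The join of `l` and the members of `U` below `z` in the coordinates `p` and `q`, with these two
coordinates replaced by `z`. -/
def joinBelow (p q : ι) (l : ι → ℤ) (U : Finset (ι → ℤ)) (z : ℤ × ℤ) : ι → ℤ := fun i =>
  if i = p then z.1 else if i = q then z.2 else
    (U.filter fun x => x p ≤ z.1 ∧ x q ≤ z.2).fold max (l i) fun x => x i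

/-- The meet of `u` and the members of `D` above `z` in the coordinates `p` and `q`, with these two
coordinates replaced by `z`. -/
def meetAbove (p q : ι) (u : ι → ℤ) (D : Finset (ι → ℤ)) (z : ℤ × ℤ) : ι → ℤ := fun i =>
  if i = p then z.1 else if i = q then z.2 else
    (D.filter fun x => z.1 ≤ x p ∧ z.2 ≤ x q).fold min (u i) fun x => x i

section joinBelow

variable {p q : ι} {l u x y : ι → ℤ} {U U' D D' : Finset (ι → ℤ)} {z z' : ℤ × ℤ}

theorem joinBelow_fst : joinBelow p q l U z p = z.1 := if_pos rfl

theorem joinBelow_snd (hpq : p ≠ q) : joinBelow p q l U z q = z.2 := by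
  simp [joinBelow, hpq.symm]

theorem meetAbove_fst : meetAbove p q u D z p = z.1 := if_pos rfl

theorem meetAbove_snd (hpq : p ≠ q) : meetAbove p q u D z q = z.2 := by
  simp [meetAbove, hpq.symm]

theorem joinBelow_le (hl : l ≤ y) (hU : ∀ x ∈ U, x p ≤ z.1 → x q ≤ z.2 → x ≤ y)
    (h₁ : z.1 ≤ y p) (h₂ : z.2 ≤ y q) : joinBelow p q l U z ≤ y := by
  intro i
  unfold joinBelow
  split_ifs with hp hq
  · exact hp ▸ h₁
  · exact hq ▸ h₂
  · rw [Finset.fold_max_le]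
    exact ⟨hl i, fun x hx => hU x (Finset.mem_filter.1 hx).1 (Finset.mem_filter.1 hx).2.1
      (Finset.mem_filter.1 hx).2.2 i⟩

theorem le_meetAbove (hu : y ≤ u) (hD : ∀ x ∈ D, z.1 ≤ x p → z.2 ≤ x q → y ≤ x)
    (h₁ : y p ≤ z.1) (h₂ : y q ≤ z.2) : y ≤ meetAbove p q u D z := by
  intro i
  unfold meetAbove
  split_ifs with hp hq
  · exact hp ▸ h₁
  · exact hq ▸ h₂
  · rw [Finset.le_fold_min]
    exact ⟨hu i, fun x hx => hD x (Finset.mem_filter.1 hx).1 (Finset.mem_filter.1 hx).2.1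
      (Finset.mem_filter.1 hx).2.2 i⟩

theorem le_joinBelow (hx : x ∈ U) (h₁ : x p ≤ z.1) (h₂ : x q ≤ z.2) :
    x ≤ joinBelow p q l U z := by
  intro i
  unfold joinBelow
  split_ifs with hp hq
  · exact hp ▸ h₁
  · exact hq ▸ h₂
  · rw [Finset.le_fold_max]
    exact .inr ⟨x, Finset.mem_filter.2 ⟨hx, h₁, h₂⟩, le_rfl⟩

theorem meetAbove_le (hx : x ∈ D) (h₁ : z.1 ≤ x p) (h₂ : z.2 ≤ x q) :
    meetAbove p q u D z ≤ x := by
  intro i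
  unfold meetAbove
  split_ifs with hp hq
  · exact hp ▸ h₁
  · exact hq ▸ h₂
  · rw [Finset.fold_min_le]
    exact .inr ⟨x, Finset.mem_filter.2 ⟨hx, h₁, h₂⟩, le_rfl⟩

theorem base_le_joinBelow (h₁ : l p ≤ z.1) (h₂ : l q ≤ z.2) : l ≤ joinBelow p q l U z := by
  intro i
  unfold joinBelow
  split_ifs with hp hq
  · exact hp ▸ h₁
  · exact hq ▸ h₂
  · rw [Finset.le_fold_max]
    exact .inl le_rfl

theorem meetAbove_le_base (h₁ : z.1 ≤ u p) (h₂ : z.2 ≤ u q) : meetAbove p q u D z ≤ u := by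
  intro i
  unfold meetAbove
  split_ifs with hp hq
  · exact hp ▸ h₁
  · exact hq ▸ h₂
  · rw [Finset.fold_min_le]
    exact .inl le_rfl

theorem joinBelow_mono (hpq : p ≠ q) (h₁ : l p ≤ z.1) (h₂ : l q ≤ z.2) (hz : z ≤ z') :
    joinBelow p q l U z ≤ joinBelow p q l U z' :=
  joinBelow_le (base_le_joinBelow (h₁.trans hz.1) (h₂.trans hz.2))
    (fun _ hx hx₁ hx₂ => le_joinBelow hx (hx₁.trans hz.1) (hx₂.trans hz.2))
    (by rw [joinBelow_fst]; exact hz.1) (by rw [joinBelow_snd hpq]; exact hz.2)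

/-- As in Tarski's theorem, a join of points moved up by a monotone map is moved up. The coordinates
`p` and `q` are prescribed by `z`, hence excluded. -/
theorem joinBelow_apply_le {g : (ι → ℤ) → (ι → ℤ)} (hg : Monotone g) {i : ι} (hp : i ≠ p)
    (hq : i ≠ q) (hl : l i ≤ g l i) (hU : ∀ x ∈ U, x i ≤ g x i) (h₁ : l p ≤ z.1)
    (h₂ : l q ≤ z.2) : joinBelow p q l U z i ≤ g (joinBelow p q l U z) i := by
  conv_lhs => rw [joinBelow, if_neg hp, if_neg hq]
  rw [Finset.fold_max_le]
  refine ⟨hl.trans (hg (base_le_joinBelow h₁ h₂) i), fun x hx => ?_⟩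
  obtain ⟨hx, hx₁, hx₂⟩ := Finset.mem_filter.1 hx
  exact (hU x hx).trans (hg (le_joinBelow hx hx₁ hx₂) i)

theorem apply_le_meetAbove {g : (ι → ℤ) → (ι → ℤ)} (hg : Monotone g) {i : ι} (hp : i ≠ p)
    (hq : i ≠ q) (hu : g u i ≤ u i) (hD : ∀ x ∈ D, g x i ≤ x i) (h₁ : z.1 ≤ u p)
    (h₂ : z.2 ≤ u q) : g (meetAbove p q u D z) i ≤ meetAbove p q u D z i := by
  conv_rhs => rw [meetAbove, if_neg hp, if_neg hq]
  rw [Finset.le_fold_min]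
  refine ⟨(hg (meetAbove_le_base h₁ h₂) i).trans hu, fun x hx => ?_⟩
  obtain ⟨hx, hx₁, hx₂⟩ := Finset.mem_filter.1 hx
  exact (hg (meetAbove_le hx hx₁ hx₂) i).trans (hD x hx)

end joinBelow

/-- The points in `U` are moved up and those in `D` moved down by `g` in the directions of `B`, and
the order of two such points in the coordinates `p` and `q` implies their order. -/
structure Records (B : Finset ι) (p q : ι) (l u : ι → ℤ) (g : (ι → ℤ) → (ι → ℤ))
    (U D : Finset (ι → ℤ)) : Prop where
  mono : Monotone g
  base : ∀ i ∈ insert p (insert q B), l i ≤ g l i ∧ g u i ≤ u i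
  up : ∀ x ∈ U, l ≤ x ∧ x ≤ u ∧ ∀ i ∈ B, x i ≤ g x i
  down : ∀ x ∈ D, l ≤ x ∧ x ≤ u ∧ ∀ i ∈ B, g x i ≤ x i
  sep : ∀ x ∈ U, ∀ y ∈ D, x p ≤ y p → x q ≤ y q → x ≤ y

section compose

variable {B : Finset ι} {p q : ι} {l u : ι → ℤ} {K n : ℕ} {U D : Finset (ι → ℤ)} {z : ℤ × ℤ}
  {g : (ι → ℤ) → (ι → ℤ)}

/-- `z` lies in the projection of the box to the coordinates `p` and `q`. -/
def InBox (p q : ι) (l u : ι → ℤ) (z : ℤ × ℤ) : Prop :=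
  (l p ≤ z.1 ∧ z.1 ≤ u p) ∧ l q ≤ z.2 ∧ z.2 ≤ u q

theorem Records.joinBelow_le_top (h : Records B p q l u g U D) (hlu : l ≤ u)
    (hz : InBox p q l u z) : joinBelow p q l U z ≤ u :=
  joinBelow_le hlu (fun x hx _ _ => (h.up x hx).2.1) hz.1.2 hz.2.2

theorem Records.bot_le_meetAbove (h : Records B p q l u g U D) (hlu : l ≤ u)
    (hz : InBox p q l u z) : l ≤ meetAbove p q u D z :=
  le_meetAbove hlu (fun x hx _ _ => (h.down x hx).1) hz.1.1 hz.2.1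

/-- This is the purpose of `sep`: the inner box over `z` is never empty. -/
theorem Records.join_le_meet (h : Records B p q l u g U D) (hlu : l ≤ u) (hpq : p ≠ q)
    (hz : InBox p q l u z) : joinBelow p q l U z ≤ meetAbove p q u D z := by
  refine le_meetAbove (h.joinBelow_le_top hlu hz) (fun y hy h₁ h₂ => ?_) joinBelow_fst.le
    (joinBelow_snd hpq).le
  exact joinBelow_le (h.down y hy).1
    (fun x hx h₃ h₄ => h.sep x hx y hy (h₃.trans h₁) (h₄.trans h₂)) h₁ h₂

/-- Whatever is recorded later, `β` tells whether `c ≤ g x t` at the joins and the meets over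
`z`. -/
def Decides (B : Finset ι) (p q : ι) (l u : ι → ℤ) (g : (ι → ℤ) → (ι → ℤ))
    (U D : Finset (ι → ℤ)) (z : ℤ × ℤ) (t : ι) (c : ℤ) (β : Bool) : Prop :=
  ∀ U' D', U ⊆ U' → D ⊆ D' → Records B p q l u g U' D' →
    (β = true ↔ c ≤ g (joinBelow p q l U' z) t) ∧ (β = true ↔ c ≤ g (meetAbove p q u D' z) t)

theorem Decides.mono {t : ι} {c : ℤ} {β : Bool} {U' D' : Finset (ι → ℤ)} (hU : U ⊆ U')
    (hD : D ⊆ D') (h : Decides B p q l u g U D z t c β) : Decides B p q l u g U' D' z t c β :=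
  fun U'' D'' h₁ h₂ => h U'' D'' (hU.trans h₁) (hD.trans h₂)

/-- A recorded up point over `z` lies below every later join over `z` and, by `sep`, below every
later meet. Monotonicity of `g` then settles the threshold for good. -/
theorem decides_of_up {x : ι → ℤ} {t : ι} {c : ℤ} (hx : x ∈ U) (hxu : x ≤ u) (hxp : x p = z.1)
    (hxq : x q = z.2) (hc : c ≤ g x t) : Decides B p q l u g U D z t c true := by
  intro U' D' hU hD h
  simp only [true_iff]
  refine ⟨hc.trans (h.mono (le_joinBelow (hU hx) hxp.le hxq.le) t), hc.trans (h.mono ?_ t)⟩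
  exact le_meetAbove hxu (fun y hy h₁ h₂ => h.sep x (hU hx) y hy (hxp ▸ h₁) (hxq ▸ h₂)) hxp.le
    hxq.le

theorem decides_of_down {x : ι → ℤ} {t : ι} {c : ℤ} (hx : x ∈ D) (hlx : l ≤ x) (hxp : x p = z.1)
    (hxq : x q = z.2) (hc : g x t < c) : Decides B p q l u g U D z t c false := by
  intro U' D' hU hD h
  simp only [Bool.false_eq_true, false_iff, not_le]
  refine ⟨(h.mono ?_ t).trans_lt hc, (h.mono (meetAbove_le (hD hx) hxp.ge hxq.ge) t).trans_lt hc⟩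
  exact joinBelow_le hlx (fun y hy h₁ h₂ => h.sep y hy x (hD hx) (hxp ▸ h₁) (hxq ▸ h₂)) hxp.ge
    hxq.ge

variable [Fintype ι]

/-- Confinement of `x` to the box between join and meet is what preserves `sep`. -/
theorem Records.insert_up (h : Records B p q l u g U D) (hz : InBox p q l u z)
    {x : ι → ℤ} (hx : joinBelow p q l U z ≤ x) (hx' : x ≤ meetAbove p q u D z) (hxp : x p = z.1)
    (hxq : x q = z.2) (hup : ∀ i ∈ B, x i ≤ g x i) : Records B p q l u g (insert x U) D := by
  refine ⟨h.mono, h.base, fun y hy => ?_, h.down, fun y hy w hw h₁ h₂ => ?_⟩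
  · rcases Finset.mem_insert.1 hy with rfl | hy
    · exact ⟨(base_le_joinBelow hz.1.1 hz.2.1).trans hx,
        hx'.trans (meetAbove_le_base hz.1.2 hz.2.2), hup⟩
    · exact h.up y hy
  · rcases Finset.mem_insert.1 hy with rfl | hy
    · exact hx'.trans (meetAbove_le hw (hxp ▸ h₁) (hxq ▸ h₂))
    · exact h.sep y hy w hw h₁ h₂

theorem Records.insert_down (h : Records B p q l u g U D) (hz : InBox p q l u z)
    {x : ι → ℤ} (hx : joinBelow p q l U z ≤ x) (hx' : x ≤ meetAbove p q u D z) (hxp : x p = z.1)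
    (hxq : x q = z.2) (hdn : ∀ i ∈ B, g x i ≤ x i) : Records B p q l u g U (insert x D) := by
  refine ⟨h.mono, h.base, h.up, fun y hy => ?_, fun w hw y hy h₁ h₂ => ?_⟩
  · rcases Finset.mem_insert.1 hy with rfl | hy
    · exact ⟨(base_le_joinBelow hz.1.1 hz.2.1).trans hx,
        hx'.trans (meetAbove_le_base hz.1.2 hz.2.2), hdn⟩
    · exact h.down y hy
  · rcases Finset.mem_insert.1 hy with rfl | hy
    · exact (le_joinBelow hw (hxp ▸ h₁) (hxq ▸ h₂)).trans hx
    · exact h.sep w hw y hy h₁ h₂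

/-- The slice problem for `B` is posed in the box between the join and the meet over `z`, whose
corners `g` moves inwards in the directions of `B`. One further evaluation tells whether its
solution is recorded as up or down. -/
theorem solves_threshold (hB : SliceSolvable B K n) (hlu : l ≤ u) (hpq : p ≠ q) (hp : p ∉ B)
    (hq : q ∉ B) (hoff : ∀ i ∉ insert p (insert q B), l i = u i) (hK : ∀ i, u i ≤ l i + 2 ^ K)
    (hz : InBox p q l u z) (t : ι) (c : ℤ) (U D : Finset (ι → ℤ)) :
    Solves (n + 1) (fun g => Records B p q l u g U D)
      (fun g (r : Finset (ι → ℤ) × Finset (ι → ℤ) × Bool) => Records B p q l u g r.1 r.2.1 ∧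
        U ⊆ r.1 ∧ D ⊆ r.2.1 ∧ Decides B p q l u g r.1 r.2.1 z t c r.2.2) := by
  -- The box depends on `U` and `D` only, but its corners are known to be ordered only if some
  -- function has these records.
  by_cases hex : ∃ g, Records B p q l u g U D
  swap
  · exact .pure (U, D, true) fun g hg => (hex ⟨g, hg⟩).elim
  obtain ⟨g₀, hg₀⟩ := hex
  have hl := base_le_joinBelow (U := U) hz.1.1 hz.2.1
  have hu := meetAbove_le_base (D := D) hz.1.2 hz.2.2
  have hju := hg₀.joinBelow_le_top hlu hz
  have hlm := hg₀.bot_le_meetAbove hlu hz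
  refine Solves.bind (G := fun (g : (ι → ℤ) → (ι → ℤ)) x => joinBelow p q l U z ≤ x ∧ x ≤ meetAbove p q u D z ∧
    ((∀ i ∈ B, x i ≤ g x i) ∧ c ≤ g x t ∨ (∀ i ∈ B, g x i ≤ x i) ∧ g x t < c))
    ((hB t c _ _ (hg₀.join_le_meet hlu hpq hz) ?_ ?_).mono le_rfl ?_ fun _ _ _ h => h) fun x =>
      .ask x fun y => ?_
  · intro i hi
    by_cases h₁ : i = p
    · rw [h₁, joinBelow_fst, meetAbove_fst]
    by_cases h₂ : i = q
    · rw [h₂, joinBelow_snd hpq, meetAbove_snd hpq]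
    have := hoff i (by simp [h₁, h₂, hi])
    linarith [hl i, hu i, hju i, hlm i]
  · intro i
    linarith [hl i, hu i, hK i]
  · refine fun g hg => ⟨hg.mono, fun i hi => ⟨?_, ?_⟩⟩
    · exact joinBelow_apply_le hg.mono (fun h => hp (h ▸ hi)) (fun h => hq (h ▸ hi))
        (hg.base i (by simp [hi])).1 (fun x hx => (hg.up x hx).2.2 i hi) hz.1.1 hz.2.1
    · exact apply_le_meetAbove hg.mono (fun h => hp (h ▸ hi)) (fun h => hq (h ▸ hi))
        (hg.base i (by simp [hi])).2 (fun x hx => (hg.down x hx).2.2 i hi) hz.1.2 hz.2.2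
  have hxp : joinBelow p q l U z ≤ x → x ≤ meetAbove p q u D z → x p = z.1 := fun h₁ h₂ =>
    le_antisymm ((h₂ p).trans meetAbove_fst.le) (joinBelow_fst.ge.trans (h₁ p))
  have hxq : joinBelow p q l U z ≤ x → x ≤ meetAbove p q u D z → x q = z.2 := fun h₁ h₂ =>
    le_antisymm ((h₂ q).trans (meetAbove_snd hpq).le) ((joinBelow_snd hpq).ge.trans (h₁ q))
  by_cases hy : (∀ i ∈ B, x i ≤ y i) ∧ c ≤ y t
  · refine .pure (insert x U, D, true) fun g hg => ?_
    obtain ⟨⟨hg, h₁, h₂, -⟩, rfl⟩ := hg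
    exact ⟨hg.insert_up hz h₁ h₂ (hxp h₁ h₂) (hxq h₁ h₂) hy.1, Finset.subset_insert _ _,
      subset_rfl, decides_of_up (Finset.mem_insert_self _ _) (h₂.trans hu) (hxp h₁ h₂)
      (hxq h₁ h₂) hy.2⟩
  · refine .pure (U, insert x D, false) fun g hg => ?_
    obtain ⟨⟨hg, h₁, h₂, h₃⟩, rfl⟩ := hg
    have hdn := h₃.resolve_left hy
    exact ⟨hg.insert_down hz h₁ h₂ (hxp h₁ h₂) (hxq h₁ h₂) hdn.1, subset_rfl,
      Finset.subset_insert _ _, decides_of_down (Finset.mem_insert_self _ _) (hl.trans h₁)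
      (hxp h₁ h₂) (hxq h₁ h₂) hdn.2⟩

theorem solves_thresholds (hB : SliceSolvable B K n) (hlu : l ≤ u) (hpq : p ≠ q) (hp : p ∉ B)
    (hq : q ∉ B) (hoff : ∀ i ∉ insert p (insert q B), l i = u i) (hK : ∀ i, u i ≤ l i + 2 ^ K)
    (hz : InBox p q l u z) (L : List (ι × ℤ)) (U D : Finset (ι → ℤ)) :
    Solves (L.length * (n + 1)) (fun g => Records B p q l u g U D)
      (fun g (r : Finset (ι → ℤ) × Finset (ι → ℤ) × (ι × ℤ → Bool)) =>
        Records B p q l u g r.1 r.2.1 ∧ U ⊆ r.1 ∧ D ⊆ r.2.1 ∧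
        ∀ a ∈ L, Decides B p q l u g r.1 r.2.1 z a.1 a.2 (r.2.2 a)) := by
  induction L generalizing U D with
  | nil => exact .pure (U, D, fun _ => true) fun g hg => ⟨hg, subset_rfl, subset_rfl, by simp⟩
  | cons a L ih =>
    rw [List.length_cons, Nat.succ_mul, Nat.add_comm]
    refine (solves_threshold hB hlu hpq hp hq hoff hK hz a.1 a.2 U D).bind ?_
    rintro ⟨U₁, D₁, β⟩
    refine Solves.bind (m := 0) ((ih U₁ D₁).mono le_rfl (fun g hg => hg.2.1)
      (fun _ _ _ h => h)) ?_
    rintro ⟨U₂, D₂, γ⟩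
    refine .pure (U₂, D₂, fun a' => if a' = a then β else γ a') fun g hg => ?_
    obtain ⟨⟨hg, -, h₁, h₂, h₃⟩, h₄, h₅, h₆, h₇⟩ := hg
    refine ⟨h₄, h₁.trans h₅, h₂.trans h₆, fun a' ha' => ?_⟩
    by_cases h : a' = a
    · subst h
      simpa using h₃.mono h₅ h₆
    · simpa [h] using h₇ a' ((List.mem_cons.1 ha').resolve_left h)

/-- The signs of `v p - z.1`, `v q - z.2` and of `c ≤ v t`. -/
def signsAt (p q t : ι) (c : ℤ) (z : ℤ × ℤ) (v : ι → ℤ) : ℤ × ℤ × ℤ :=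
  ((v p - z.1).sign, (v q - z.2).sign, if c ≤ v t then 1 else -1)

theorem sign_sub_eq_ite (a z : ℤ) :
    (a - z).sign = if z + 1 ≤ a then 1 else if z ≤ a then 0 else -1 := by
  split_ifs
  · exact Int.sign_eq_one_of_pos (by omega)
  · rw [show a - z = 0 by omega, Int.sign_zero]
  · exact Int.sign_eq_neg_one_of_neg (by omega)

/-- Whatever is recorded later, the joins and the meets over `z` have the signs `s`. -/
def DecidesSigns (B : Finset ι) (p q : ι) (l u : ι → ℤ) (g : (ι → ℤ) → (ι → ℤ))
    (U D : Finset (ι → ℤ)) (z : ℤ × ℤ) (t : ι) (c : ℤ) (s : ℤ × ℤ × ℤ) : Prop :=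
  ∀ U' D', U ⊆ U' → D ⊆ D' → Records B p q l u g U' D' →
    signsAt p q t c z (g (joinBelow p q l U' z)) = s ∧
    signsAt p q t c z (g (meetAbove p q u D' z)) = s

/-- Comparing `v p` with `z.1` and `z.1 + 1` gives a three-valued sign, likewise for `q`; with the
threshold `c` for `t` this makes five comparisons. -/
theorem solves_signs (hB : SliceSolvable B K n) (hlu : l ≤ u) (hpq : p ≠ q) (hp : p ∉ B)
    (hq : q ∉ B) (hoff : ∀ i ∉ insert p (insert q B), l i = u i) (hK : ∀ i, u i ≤ l i + 2 ^ K)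
    (hz : InBox p q l u z) (t : ι) (c : ℤ) (U D : Finset (ι → ℤ)) :
    Solves (5 * (n + 1)) (fun g => Records B p q l u g U D)
      (fun g (r : Finset (ι → ℤ) × Finset (ι → ℤ) × (ℤ × ℤ × ℤ)) =>
        Records B p q l u g r.1 r.2.1 ∧ U ⊆ r.1 ∧ D ⊆ r.2.1 ∧
        DecidesSigns B p q l u g r.1 r.2.1 z t c r.2.2) := by
  refine (solves_thresholds hB hlu hpq hp hq hoff hK hz
    [(p, z.1), (p, z.1 + 1), (q, z.2), (q, z.2 + 1), (t, c)] U D).bind (m := 0) ?_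
  rintro ⟨U', D', β⟩
  refine .pure (U', D', if β (p, z.1 + 1) then 1 else if β (p, z.1) then 0 else -1,
    if β (q, z.2 + 1) then 1 else if β (q, z.2) then 0 else -1,
    if β (t, c) then 1 else -1) ?_
  rintro g ⟨-, h₁, h₂, h₃, h₄⟩
  refine ⟨h₁, h₂, h₃, fun U'' D'' h₅ h₆ h₇ => ?_⟩
  simp only [List.forall_mem_cons] at h₄
  have a1 := h₄.1 U'' D'' h₅ h₆ h₇
  have a2 := h₄.2.1 U'' D'' h₅ h₆ h₇
  have a3 := h₄.2.2.1 U'' D'' h₅ h₆ h₇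
  have a4 := h₄.2.2.2.1 U'' D'' h₅ h₆ h₇
  have a5 := h₄.2.2.2.2.1 U'' D'' h₅ h₆ h₇
  simp only [signsAt, sign_sub_eq_ite]
  constructor
  · simp only [a1.1, a2.1, a3.1, a4.1, a5.1]
  · simp only [a1.2, a2.2, a3.2, a4.2, a5.2]

end compose
end RootFinding

/-! ### Fixed points by plain iteration; adding two coordinates to a slice problem. -/

namespace RootFinding
variable {ι : Type}

/-- Iterating a monotone function from a point that it moves up. -/
theorem solves_fixedPoint_of_sum [Fintype ι] (n : ℕ) (l u : ι → ℤ) (hlu : l ≤ u)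
    (hn : ∑ i, (u i - l i) ≤ n) :
    Solves (n + 1) (fun g : (ι → ℤ) → (ι → ℤ) => Monotone g ∧ l ≤ g l ∧ g u ≤ u)
      (fun g x => l ≤ x ∧ x ≤ u ∧ g x = x) := by
  induction n generalizing l with
  | zero =>
    refine .ask l fun y => .pure l fun g hg => ⟨le_rfl, hlu, ?_⟩
    obtain ⟨⟨hg, hl, hu⟩, -⟩ := hg
    have h0 : ∑ i, (u i - l i) = 0 :=
      le_antisymm (by simpa using hn) (Finset.sum_nonneg fun i _ => sub_nonneg.2 (hlu i))
    have e : l = u := by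
      funext i
      have := (Finset.sum_eq_zero_iff_of_nonneg fun i _ => sub_nonneg.2 (hlu i)).1 h0 i
        (Finset.mem_univ i)
      linarith
    exact le_antisymm (by rw [e]; exact hu) hl
  | succ n ih =>
    refine .ask l fun y => ?_
    by_cases hy : l < y ∧ y ≤ u
    · have hlt : ∑ i, (u i - y i) < ∑ i, (u i - l i) := by
        obtain ⟨hle, i, hi⟩ := Pi.lt_def.1 hy.1
        exact Finset.sum_lt_sum (fun j _ => sub_le_sub_left (hle j) _)
          ⟨i, Finset.mem_univ i, sub_lt_sub_left hi _⟩
      refine (ih y hy.2 (by push_cast at hn; omega)).mono le_rfl ?_ ?_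
      · rintro g ⟨⟨hg, hl, hu⟩, rfl⟩
        exact ⟨hg, hg hl, hu⟩
      · rintro g x - ⟨h₁, h₂, h₃⟩
        exact ⟨hy.1.le.trans h₁, h₂, h₃⟩
    · refine .pure l fun g hg => ⟨le_rfl, hlu, ?_⟩
      obtain ⟨⟨hg, hl, hu⟩, rfl⟩ := hg
      by_contra hne
      exact hy ⟨lt_of_le_of_ne hl (Ne.symm hne), (hg hlu).trans hu⟩

section compose

variable {B : Finset ι} {p q : ι} {l u : ι → ℤ} {K n : ℕ} {U D : Finset (ι → ℤ)} {z : ℤ × ℤ}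
  {g : (ι → ℤ) → (ι → ℤ)}

/-- The nearest point of the projection of the box. -/
def clampTo (p q : ι) (l u : ι → ℤ) (z : ℤ × ℤ) : ℤ × ℤ :=
  (max (l p) (min (u p) z.1), max (l q) (min (u q) z.2))

theorem inBox_clampTo (hlu : l ≤ u) (z : ℤ × ℤ) : InBox p q l u (clampTo p q l u z) := by
  have hp : l p ≤ u p := hlu p
  have hq : l q ≤ u q := hlu q
  simp only [InBox, clampTo]
  omega

theorem clampTo_of_inBox (hz : InBox p q l u z) : clampTo p q l u z = z := by
  simp only [InBox] at hz
  ext <;> simp only [clampTo] <;> omega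

variable [DecidableEq ι]

/-- The planar signs induced by `g` at the joins of the recorded points. -/
def outerSigns (p q t : ι) (c : ℤ) (l u : ι → ℤ) (g : (ι → ℤ) → (ι → ℤ)) (U : Finset (ι → ℤ))
    (z : ℤ × ℤ) : ℤ × ℤ × ℤ :=
  signsAt p q t c (clampTo p q l u z) (g (joinBelow p q l U (clampTo p q l u z)))

/-- Raising `y` by `k` lowers the sign by at most `k`, while `x` rises by at least `k`. In the
application `y` is the clamped value of `x`. -/
theorem add_sign_sub_le {x x' y y' a a' : ℤ} (hx : x ≤ x') (ha : a ≤ a') (hy : y ≤ y')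
    (hxy : x - y ≤ x' - y') : x + (a - y).sign ≤ x' + (a' - y').sign := by
  rw [sign_sub_eq_ite, sign_sub_eq_ite]
  split_ifs <;> omega

theorem sign_bound (a : ℤ) : -1 ≤ a.sign ∧ a.sign ≤ 1 := by
  rcases Int.sign_trichotomy a with h | h | h <;> omega

theorem planarMono_outerSigns (hg : Monotone g) (hlu : l ≤ u) (hpq : p ≠ q) (t : ι) (c : ℤ) :
    PlanarMono (outerSigns p q t c l u g U) := by
  have key : ∀ x y x' y' : ℤ, x ≤ x' → y ≤ y' →
      g (joinBelow p q l U (clampTo p q l u (x, y))) ≤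
        g (joinBelow p q l U (clampTo p q l u (x', y'))) := by
    intro x y x' y' h₁ h₂
    have hb := inBox_clampTo (p := p) (q := q) hlu (x, y)
    refine hg (joinBelow_mono hpq hb.1.1 hb.2.1 ⟨?_, ?_⟩) <;> simp only [clampTo] <;> omega
  refine ⟨?_, ?_, ?_, fun x y => sign_bound _, fun x y => sign_bound _, ?_⟩
  · intro x y x' y' h₁ h₂
    have hp : l p ≤ u p := hlu p
    refine add_sign_sub_le h₁ (key x y x' y' h₁ h₂ p) ?_ ?_ <;> simp only [clampTo] <;> omega
  · intro x y x' y' h₁ h₂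
    have hq : l q ≤ u q := hlu q
    refine add_sign_sub_le h₂ (key x y x' y' h₁ h₂ q) ?_ ?_ <;> simp only [clampTo] <;> omega
  · intro x y x' y' h₁ h₂
    have hle := key x y x' y' h₁ h₂ t
    simp only [outerSigns, signsAt]
    split_ifs with h h'
    · exact le_rfl
    · exact (h' (h.trans hle)).elim
    · norm_num
    · exact le_rfl
  · intro x y
    simp only [outerSigns, signsAt]
    split_ifs <;> omega

variable [Fintype ι]

/-- A planar procedure can be run on the signs induced by the recorded points, which are found on
demand. -/
theorem exists_simulation (hB : SliceSolvable B K n) (hlu : l ≤ u) (hpq : p ≠ q) (hp : p ∉ B)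
    (hq : q ∉ B) (hoff : ∀ i ∉ insert p (insert q B), l i = u i) (hK : ∀ i, u i ≤ l i + 2 ^ K)
    (t : ι) (c : ℤ) {R : Type} (T : QueryTree (ℤ × ℤ) (ℤ × ℤ × ℤ) R) (U D : Finset (ι → ℤ)) :
    ∃ T' : QueryTree (ι → ℤ) (ι → ℤ) (Finset (ι → ℤ) × Finset (ι → ℤ) × R),
      ∀ g, Records B p q l u g U D →
        Records B p q l u g (T'.result g).1 (T'.result g).2.1 ∧
        U ⊆ (T'.result g).1 ∧ D ⊆ (T'.result g).2.1 ∧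
        (∀ U' D', (T'.result g).1 ⊆ U' → (T'.result g).2.1 ⊆ D' → Records B p q l u g U' D' →
          T.result (outerSigns p q t c l u g U') = (T'.result g).2.2) ∧
        T'.cost g ≤ 5 * (n + 1) * T.cost (outerSigns p q t c l u g (T'.result g).1) := by
  induction T generalizing U D with
  | pure r =>
    exact ⟨.pure (U, D, r), fun g hg => ⟨hg, subset_rfl, subset_rfl, fun _ _ _ _ _ => rfl,
      Nat.zero_le _⟩⟩
  | ask z next ih =>
    obtain ⟨A, hA⟩ :=
      solves_signs hB hlu hpq hp hq hoff hK (inBox_clampTo (p := p) (q := q) hlu z) t c U D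
    choose T' hT' using ih
    refine ⟨A.bind fun r => T' r.2.2 r.1 r.2.1, fun g hg => ?_⟩
    obtain ⟨⟨h₁, h₂, h₃, h₄⟩, h₅⟩ := hA g hg
    rw [QueryTree.result_bind, QueryTree.cost_bind]
    generalize A.result g = r at *
    obtain ⟨h₆, h₇, h₈, h₉, h₁₀⟩ := hT' r.2.2 r.1 r.2.1 g h₁
    refine ⟨h₆, h₂.trans h₇, h₃.trans h₈, fun U' D' hU hD hg' => ?_, ?_⟩
    -- The planar function is fixed only by the later records `U'`; `DecidesSigns` ensures that this
    -- early answer is still its value at `z`.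
    · have e : outerSigns p q t c l u g U' z = r.2.2 :=
        (h₄ U' D' (h₇.trans hU) (h₈.trans hD) hg').1
      rw [QueryTree.result, e]
      exact h₉ U' D' hU hD hg'
    · have e : outerSigns p q t c l u g ((T' r.2.2 r.1 r.2.1).result g).1 z = r.2.2 :=
        (h₄ _ _ h₇ h₈ h₆).1
      rw [QueryTree.cost, e, Nat.mul_succ]
      omega

/-- The planar procedure yields `z` with agreeing signs, and one more round of thresholds at `z`,
the final `+ 1`, reveals their direction. The join and the meet over `z` have the same signs, and in
the directions of `B` the join is moved up and the meet down, so one of them is a solution. -/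
theorem SliceSolvable.insert_insert (hB : SliceSolvable B K n) (hpq : p ≠ q) (hp : p ∉ B)
    (hq : q ∉ B) :
    SliceSolvable (insert p (insert q B)) K (5 * (n + 1) * (25 * (2 * K + 1) + 1)) := by
  intro t c l u hlu hoff hK
  obtain ⟨T, hT⟩ := solves_planar K (hlu p) (hlu q) (hK p) (hK q)
  obtain ⟨T', hT'⟩ := exists_simulation hB hlu hpq hp hq hoff hK t c T ∅ ∅
  have houter : ∀ g U D, Records B p q l u g U D →
      (InBox p q l u (T.result (outerSigns p q t c l u g U)) ∧
        AgreeAt (outerSigns p q t c l u g U) (T.result (outerSigns p q t c l u g U))) ∧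
      T.cost (outerSigns p q t c l u g U) ≤ 25 * (2 * K + 1) := by
    intro g U D hg
    have hl : InBox p q l u (l p, l q) := ⟨⟨le_rfl, hlu p⟩, le_rfl, hlu q⟩
    have hu : InBox p q l u (u p, u q) := ⟨⟨hlu p, le_rfl⟩, hlu q, le_rfl⟩
    have hl' := hg.mono (base_le_joinBelow (U := U) hl.1.1 hl.2.1)
    have hu' := hg.mono (hg.joinBelow_le_top hlu hu)
    have hp' := hg.base p (by simp)
    have hq' := hg.base q (by simp)
    obtain ⟨⟨⟨h₁, h₂, h₃, h₄⟩, h₅⟩, h₆⟩ := hT (outerSigns p q t c l u g U)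
      ⟨planarMono_outerSigns hg.mono hlu hpq t c, by
        simp only [outerSigns, clampTo_of_inBox hl, clampTo_of_inBox hu, signsAt,
          Int.sign_nonneg_iff, Int.sign_nonpos_iff]
        refine ⟨⟨?_, ?_⟩, ?_, ?_⟩ <;>
          linarith [hl' p, hl' q, hu' p, hu' q]⟩
    exact ⟨⟨⟨⟨h₁, h₂⟩, h₃, h₄⟩, h₅⟩, h₆⟩
  have hsim : Solves (5 * (n + 1) * (25 * (2 * K + 1)))
      (fun g : (ι → ℤ) → (ι → ℤ) => Monotone g ∧
        ∀ i ∈ insert p (insert q B), l i ≤ g l i ∧ g u i ≤ u i)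
      (fun g (r : Finset (ι → ℤ) × Finset (ι → ℤ) × (ℤ × ℤ)) =>
        Records B p q l u g r.1 r.2.1 ∧ InBox p q l u r.2.2 ∧
        ∀ U' D', r.1 ⊆ U' → r.2.1 ⊆ D' → Records B p q l u g U' D' →
          AgreeAt (outerSigns p q t c l u g U') r.2.2) := by
    refine ⟨T', fun g hg => ?_⟩
    obtain ⟨h₁, -, -, h₂, h₃⟩ := hT' g ⟨hg.1, hg.2, by simp, by simp, by simp⟩
    refine ⟨⟨h₁, ?_, fun U' D' hU hD hg' => ?_⟩, h₃.trans (Nat.mul_le_mul_left _ ?_)⟩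
    · rw [← h₂ _ _ subset_rfl subset_rfl h₁]
      exact (houter g _ _ h₁).1.1
    · rw [← h₂ _ _ hU hD hg']
      exact (houter g _ _ hg').1.2
    · exact (houter g _ _ h₁).2
  rw [Nat.mul_succ]
  refine hsim.bind ?_
  rintro ⟨U, D, z⟩
  by_cases hz : InBox p q l u z
  swap
  · exact .pure l fun g hg => (hz hg.2.2.1).elim
  refine Solves.bind (m := 0) ((solves_signs hB hlu hpq hp hq hoff hK hz t c U D).mono le_rfl
    (fun g hg => hg.2.1) fun _ _ _ h => h) ?_
  rintro ⟨U', D', s⟩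
  by_cases hs : 0 ≤ s.1 ∧ 0 ≤ s.2.1 ∧ s.2.2 = 1
  · refine .pure (joinBelow p q l U' z) fun g hg => ?_
    obtain ⟨-, h₁, h₂, h₃, h₄⟩ := hg
    have e : _ = s := (h₄ U' D' subset_rfl subset_rfl h₁).1
    rw [← e] at hs
    simp only [signsAt, Int.sign_nonneg_iff] at hs
    refine ⟨base_le_joinBelow hz.1.1 hz.2.1, h₁.joinBelow_le_top hlu hz, .inl ⟨?_, ?_⟩⟩
    · intro i hi
      by_cases hip : i = p
      · rw [hip, joinBelow_fst]
        exact sub_nonneg.1 hs.1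
      by_cases hiq : i = q
      · rw [hiq, joinBelow_snd hpq]
        exact sub_nonneg.1 hs.2.1
      have hiB : i ∈ B := by simpa [hip, hiq] using hi
      exact joinBelow_apply_le h₁.mono hip hiq (h₁.base i hi).1
        (fun x hx => (h₁.up x hx).2.2 i hiB) hz.1.1 hz.2.1
    · by_contra hc
      simp [hc] at hs
  · refine .pure (meetAbove p q u D' z) fun g hg => ?_
    obtain ⟨⟨-, -, -, h₀⟩, h₁, h₂, h₃, h₄⟩ := hg
    have e : _ = s ∧ _ = s := h₄ U' D' subset_rfl subset_rfl h₁
    have ha := h₀ U' D' h₂ h₃ h₁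
    have e' : outerSigns p q t c l u g U' z = s := by
      rw [outerSigns, clampTo_of_inBox hz, e.1]
    simp only [AgreeAt, Agree, Prod.mk.eta, e'] at ha
    replace ha := ha.resolve_left hs
    rw [← e.2] at ha
    simp only [signsAt, Int.sign_nonpos_iff] at ha
    refine ⟨h₁.bot_le_meetAbove hlu hz, meetAbove_le_base hz.1.2 hz.2.2, .inr ⟨?_, ?_⟩⟩
    · intro i hi
      by_cases hip : i = p
      · rw [hip, meetAbove_fst]
        exact sub_nonpos.1 ha.1
      by_cases hiq : i = q
      · rw [hiq, meetAbove_snd hpq]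
        exact sub_nonpos.1 ha.2.1
      have hiB : i ∈ B := by simpa [hip, hiq] using hi
      exact apply_le_meetAbove h₁.mono hip hiq (h₁.base i hi).2
        (fun x hx => (h₁.down x hx).2.2 i hiB) hz.1.2 hz.2.2
    · by_contra hc
      simp [not_lt.1 hc] at ha

theorem sliceSolvable_of_card (K m : ℕ) (S : Finset ι) (hS : S.card = 2 * m) :
    SliceSolvable S K ((500 * (K + 1)) ^ m) := by
  induction m generalizing S with
  | zero =>
    rw [Finset.card_eq_zero.1 hS]
    exact SliceSolvable.empty K
  | succ m ih =>
    obtain ⟨p, S', hp, rfl, hS'⟩ := Finset.card_eq_succ.1 (hS.trans (Nat.mul_succ 2 m))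
    obtain ⟨q, B, hq, rfl, hB⟩ := Finset.card_eq_succ.1 hS'
    rw [Finset.mem_insert, not_or] at hp
    intro t c l u hlu hoff hK
    refine ((ih B hB).insert_insert hp.1 hp.2 hq t c l u hlu hoff hK).mono ?_ (fun _ h => h)
      fun _ _ _ h => h
    -- For `n ≥ 1`, `5 * (n + 1) * (50 * K + 26) ≤ 10 * n * (50 * K + 26) ≤ 500 * (K + 1) * n`.
    have h1 : 1 ≤ (500 * (K + 1)) ^ m := Nat.one_le_pow _ _ (by omega)
    rw [pow_succ]
    nlinarith

end compose

/-! ### Bisection by slices in odd dimension. -/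

variable [DecidableEq ι]

/-- Bisection of the coordinates one after the other. -/
theorem solves_fixedPoint_of_slices [Fintype ι] {K n : ℕ}
    (hS : ∀ t : ι, SliceSolvable (Finset.univ.erase t) K n) (N : ℕ) (k : ι → ℕ)
    (hN : ∑ i, k i ≤ N) (hkK : ∀ i, k i ≤ K) (l u : ι → ℤ) (hlu : l ≤ u)
    (hk : ∀ i, u i ≤ l i + 2 ^ k i) :
    Solves (N * (n + 1) + (Fintype.card ι + 1))
      (fun g : (ι → ℤ) → (ι → ℤ) => Monotone g ∧ l ≤ g l ∧ g u ≤ u)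
      (fun g x => l ≤ x ∧ x ≤ u ∧ g x = x) := by
  induction N generalizing k l u with
  | zero =>
    have hk0 : ∀ i, k i = 0 := by
      simpa using Nat.le_zero.1 hN
    -- All sides now have length at most one, so plain iteration is cheap.
    refine (solves_fixedPoint_of_sum (Fintype.card ι) l u hlu ?_).mono (by omega)
      (fun _ h => h) fun _ _ _ h => h
    calc ∑ i, (u i - l i) ≤ ∑ _i : ι, (1 : ℤ) := Finset.sum_le_sum fun i _ => by
          have := hk i
          rw [hk0 i] at this
          simpa [add_comm] using this
      _ = Fintype.card ι := by simp
  | succ N ih =>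
    by_cases hall : ∀ i, k i = 0
    · exact (ih k (by simp [hall]) hkK l u hlu hk).mono (by rw [Nat.succ_mul]; omega)
        (fun _ h => h) fun _ _ _ h => h
    obtain ⟨t, ht⟩ := not_forall.1 hall
    obtain ⟨j, hj⟩ : ∃ j, k t = j + 1 := ⟨k t - 1, by omega⟩
    have hkt := hk t
    have hlut : l t ≤ u t := hlu t
    rw [hj, pow_succ] at hkt
    set c := l t + (u t - l t) / 2 with hc
    have hk' : ∑ i, Function.update k t j i ≤ N := by
      have h1 := Finset.sum_update_of_mem (Finset.mem_univ t) k j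
      have h2 := Finset.add_sum_erase Finset.univ k (Finset.mem_univ t)
      rw [Finset.sdiff_singleton_eq_erase] at h1
      omega
    have hkK' : ∀ i, Function.update k t j i ≤ K := by
      intro i
      have := hkK i
      by_cases h : i = t
      · subst h; simp; omega
      · simpa [h] using this
    have hl' : l ≤ Function.update l t c := by
      rw [le_update_iff]
      exact ⟨by omega, fun _ _ => le_rfl⟩
    have hu' : Function.update u t c ≤ u := by
      rw [update_le_iff]
      exact ⟨by omega, fun _ _ => le_rfl⟩
    rw [show (N + 1) * (n + 1) + (Fintype.card ι + 1)
      = n + (N * (n + 1) + (Fintype.card ι + 1) + 1) by ring]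
    refine Solves.bind ((hS t t c (Function.update l t c) (Function.update u t c) ?_ ?_ ?_).mono
      le_rfl ?_ fun _ _ _ h => h) fun x => .ask x fun y => ?_
    · exact update_le_update_iff.2 ⟨le_rfl, fun i _ => hlu i⟩
    · intro i hi
      obtain rfl : i = t := by simpa using hi
      simp
    · intro i
      by_cases h : i = t
      · subst h; simp
      · have := hk i
        have : (2 : ℤ) ^ k i ≤ 2 ^ K := pow_le_pow_right₀ (by norm_num) (hkK i)
        simp only [Function.update_of_ne h]
        omega
    · rintro g ⟨hg, hl, hu⟩
      refine ⟨hg, fun i hi => ?_⟩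
      have hit := (Finset.mem_erase.1 hi).1
      rw [Function.update_of_ne hit, Function.update_of_ne hit]
      exact ⟨(hl i).trans (hg hl' i), (hg hu' i).trans (hu i)⟩
    have hxc : Function.update l t c ≤ x → x ≤ Function.update u t c → x t = c := fun h₁ h₂ =>
      le_antisymm (by simpa using h₂ t) (by simpa using h₁ t)
    by_cases hx : (Function.update l t c ≤ x ∧ x ≤ Function.update u t c) ∧ x t = c
    swap
    · refine .pure l fun g hg => (hx ?_).elim
      obtain ⟨⟨-, h₁, h₂, -⟩, -⟩ := hg
      exact ⟨⟨h₁, h₂⟩, hxc h₁ h₂⟩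
    obtain ⟨⟨hlx, hxu⟩, hxt⟩ := hx
    have hlx' := hl'.trans hlx
    have hxu' := hxu.trans hu'
    -- As `x t = c`, the two outcomes of the slice problem give `x ≤ g x` or `g x ≤ x`; accordingly
    -- `[x, u]` or `[l, x]` again has its corners moved inwards.
    by_cases hy : x ≤ y
    · refine (ih (Function.update k t j) hk' hkK' x u hxu' ?_).mono le_rfl ?_ ?_
      · intro i
        by_cases h : i = t
        · subst h
          simp only [Function.update_self]
          omega
        · simp only [Function.update_of_ne h]
          linarith [hk i, hlx' i]
      · rintro g ⟨⟨⟨hg, hl, hu⟩, -⟩, rfl⟩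
        exact ⟨hg, hy, hu⟩
      · rintro g w - ⟨h₁, h₂, h₃⟩
        exact ⟨hlx'.trans h₁, h₂, h₃⟩
    · refine (ih (Function.update k t j) hk' hkK' l x hlx' ?_).mono le_rfl ?_ ?_
      · intro i
        by_cases h : i = t
        · subst h
          simp only [Function.update_self]
          omega
        · simp only [Function.update_of_ne h]
          linarith [hk i, hxu' i]
      · rintro g ⟨⟨⟨hg, hl, hu⟩, -, -, h⟩, rfl⟩
        refine ⟨hg, hl, fun i => ?_⟩
        have hmem : ∀ i, i ≠ t → i ∈ Finset.univ.erase t := fun i hi => by simp [hi]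
        rcases h with ⟨h₁, h₂⟩ | ⟨h₁, h₂⟩
        · refine (hy fun i => ?_).elim
          by_cases hit : i = t
          · rw [hit, hxt]; exact h₂
          · exact h₁ i (hmem i hit)
        · by_cases hit : i = t
          · rw [hit, hxt]; exact h₂.le
          · exact h₁ i (hmem i hit)
      · rintro g w - ⟨h₁, h₂, h₃⟩
        exact ⟨h₁, h₂.trans hxu', h₃⟩

/-- A fixed point of a monotone function on a grid of odd dimension `2 * m + 1`. -/
theorem solves_fixedPoint [Fintype ι] {m : ℕ} (hι : Fintype.card ι = 2 * m + 1) (K : ℕ)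
    (l u : ι → ℤ) (hlu : l ≤ u) (hK : ∀ i, u i ≤ l i + 2 ^ K) :
    Solves (4 * (2 * m + 1) * (500 * (K + 1)) ^ (m + 1))
      (fun g : (ι → ℤ) → (ι → ℤ) => Monotone g ∧ l ≤ g l ∧ g u ≤ u)
      (fun g x => l ≤ x ∧ x ≤ u ∧ g x = x) := by
  refine (solves_fixedPoint_of_slices (fun t => sliceSolvable_of_card K m _ ?_)
    ((2 * m + 1) * K) (fun _ => K) ?_ (fun _ => le_rfl) l u hlu hK).mono ?_ (fun _ h => h)
    fun _ _ _ h => h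
  · rw [Finset.card_erase_of_mem (Finset.mem_univ t), Finset.card_univ, hι]
    rfl
  · simp [hι]
  · rw [hι, pow_succ]
    have h1 : 1 ≤ (500 * (K + 1)) ^ m := Nat.one_le_pow _ _ (by omega)
    generalize (500 * (K + 1)) ^ m = P at *
    have h2 : K * (P + 1) + 2 ≤ 4 * (P * (500 * (K + 1))) := by nlinarith
    nlinarith [Nat.mul_le_mul_left (2 * m + 1) h2]

end RootFinding

/-! ### Discretization: from functions on `[a, b]` to monotone maps on a grid. -/

namespace RootFinding
variable {d : ℕ} {a b : Fin d → ℝ}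

/-- The coordinates are changed one at a time, and direction `i` needs no change. -/
theorem ExDiagonalDecreasing.apply_le {f : Set.Icc a b → (Fin d → ℝ)}
    (hf : ExDiagonalDecreasing f) {x y : Set.Icc a b} (hxy : x ≤ y) {i : Fin d}
    (hi : x.1 i = y.1 i) : f y i ≤ f x i := by
  have hmem : ∀ s : Finset (Fin d), (fun k => if k ∈ s then y.1 k else x.1 k) ∈ Set.Icc a b := by
    intro s
    constructor <;> intro k <;> dsimp only <;> split_ifs
    exacts [y.2.1 k, x.2.1 k, y.2.2 k, x.2.2 k]
  have key : ∀ s : Finset (Fin d), f ⟨_, hmem s⟩ i ≤ f x i := by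
    intro s
    induction s using Finset.induction_on with
    | empty => simp
    | insert j s hj ih =>
      by_cases hij : i = j
      · subst hij
        refine le_of_eq_of_le ?_ ih
        congr 2
        funext k
        by_cases hk : k = i
        · subst hk; simp [hi]
        · simp [hk]
      · refine le_trans (hf i j hij _ _ ?_ ?_) ih
        · intro k hk
          simp [hk]
        · simpa [hj] using hxy j
  simpa using key Finset.univ

/-- The nearest integer in `[0, 2 ^ K]`. -/
def clampPow (K : ℕ) (x : ℤ) : ℤ := max 0 (min (2 ^ K) x)

theorem clampPow_mono {K : ℕ} {x y : ℤ} (h : x ≤ y) : clampPow K x ≤ clampPow K y := by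
  simp only [clampPow]
  omega

theorem clampPow_of_mem {K : ℕ} {x : ℤ} (h : 0 ≤ x) (h' : x ≤ 2 ^ K) : clampPow K x = x := by
  simp only [clampPow]
  omega

theorem clampPow_nonneg (K : ℕ) (x : ℤ) : 0 ≤ clampPow K x := le_max_left _ _

theorem clampPow_le (K : ℕ) (x : ℤ) : clampPow K x ≤ 2 ^ K := by
  have : (0 : ℤ) ≤ 2 ^ K := by positivity
  simp only [clampPow]
  omega

variable {ε : Type}

/-- The point of the grid with `2 ^ K` steps in each direction of `[a, b]` with the given indices.
The directions in `ε` are ignored. -/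
noncomputable def gridPoint (hab : ∀ i, a i < b i) (K : ℕ) (x : Fin d ⊕ ε → ℤ) : Set.Icc a b :=
  ⟨fun i => a i + clampPow K (x (.inl i)) * ((b i - a i) / 2 ^ K), by
    have hpos : ∀ i, 0 ≤ (b i - a i) / 2 ^ K := fun i =>
      div_nonneg (sub_nonneg.2 (hab i).le) (by positivity)
    refine ⟨fun i => ?_, fun i => ?_⟩
    · have h : (0 : ℝ) ≤ clampPow K (x (.inl i)) := by exact_mod_cast clampPow_nonneg _ _
      have := mul_nonneg h (hpos i)
      dsimp only
      linarith
    · have h : (clampPow K (x (.inl i)) : ℝ) ≤ 2 ^ K := by exact_mod_cast clampPow_le _ _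
      have h2 := mul_le_mul_of_nonneg_right h (hpos i)
      rw [mul_div_cancel₀ _ (by positivity)] at h2
      dsimp only
      linarith⟩

theorem gridPoint_apply (hab : ∀ i, a i < b i) (K : ℕ) (x : Fin d ⊕ ε → ℤ) (i : Fin d) :
    (gridPoint hab K x).1 i = a i + clampPow K (x (.inl i)) * ((b i - a i) / 2 ^ K) := rfl

theorem gridPoint_mono (hab : ∀ i, a i < b i) (K : ℕ) :
    Monotone (gridPoint (ε := ε) hab K) := by
  intro x y hxy i
  change (gridPoint hab K x).1 i ≤ (gridPoint hab K y).1 i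
  rw [gridPoint_apply, gridPoint_apply]
  have h : (clampPow K (x (.inl i)) : ℝ) ≤ clampPow K (y (.inl i)) := by
    exact_mod_cast clampPow_mono (hxy (.inl i))
  have := mul_le_mul_of_nonneg_right h
    (div_nonneg (sub_nonneg.2 (hab i).le) (by positivity : (0 : ℝ) ≤ 2 ^ K))
  linarith

open Classical in
/-- The sign of `-v`, where values in `[-η, η]` count as zero. -/
noncomputable def negSign (η v : ℝ) : ℤ := if η < v then -1 else if v < -η then 1 else 0

theorem negSign_bound (η v : ℝ) : -1 ≤ negSign η v ∧ negSign η v ≤ 1 := by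
  unfold negSign
  split_ifs <;> omega

theorem negSign_anti {η v w : ℝ} (h : v ≤ w) (hη : 0 ≤ η) : negSign η w ≤ negSign η v := by
  unfold negSign
  split_ifs <;> first | (exfalso; linarith) | norm_num

theorem negSign_nonneg {η v : ℝ} (h : v ≤ η) : 0 ≤ negSign η v := by
  unfold negSign
  rw [if_neg (not_lt.2 h)]
  split_ifs <;> norm_num

theorem negSign_nonpos {η v : ℝ} (h : -η ≤ v) : negSign η v ≤ 0 := by
  unfold negSign
  rw [if_neg (not_lt.2 h)]
  split_ifs <;> norm_num

theorem abs_le_of_negSign_eq_zero {η v : ℝ} (h : negSign η v = 0) : |v| ≤ η := by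
  unfold negSign at h
  refine abs_le.2 ⟨not_lt.1 fun h₂ => ?_, not_lt.1 fun h₁ => ?_⟩
  · split_ifs at h; omega
  · simp [h₁] at h

/-- The move of the grid point with indices `x` that corresponds to the value `y` of `f` there. -/
noncomputable def gridMove (K : ℕ) (η : ℝ) (x : Fin d ⊕ ε → ℤ) (y : Fin d → ℝ) :
    Fin d ⊕ ε → ℤ :=
  Sum.elim (fun i => clampPow K (x (.inl i)) + negSign η (y i)) fun _ => 0

/-- Moves of at most one cannot overcome a gap of two between the clamped indices, and for equal
indices the ex-diagonal conditions suffice. For a gap of one, take `y` with index `x i` in direction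
`i` and those of `x'` elsewhere: `f i` does not increase from `x` to `y`, and from `y` to `x'`, a
single grid step, the sign cannot drop by two. -/
theorem gridMove_mono [DecidableEq ε] (hab : ∀ i, a i < b i) {K : ℕ} {η δ : ℝ} (hη : 0 ≤ η)
    (hδ : 0 ≤ δ) (hK : ∀ i, (b i - a i) / 2 ^ K ≤ δ) {f : Set.Icc a b → (Fin d → ℝ)}
    (hf : ExDiagonalDecreasing f)
    (hfδ : ∀ x x' i, ‖x.1 - x'.1‖ ≤ δ → η < f x i → -η ≤ f x' i) :
    Monotone fun x : Fin d ⊕ ε → ℤ => gridMove K η x (f (gridPoint hab K x)) := by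
  rintro x x' hxx (i | i)
  swap
  · exact le_rfl
  simp only [gridMove, Sum.elim_inl]
  have hc := clampPow_mono (K := K) (hxx (.inl i))
  have hb₁ := negSign_bound η (f (gridPoint hab K x) i)
  have hb₂ := negSign_bound η (f (gridPoint hab K x') i)
  set y := Function.update x' (.inl i) (x (.inl i)) with hy
  have hyi : (gridPoint hab K x).1 i = (gridPoint hab K y).1 i := by
    simp [gridPoint_apply, hy]
  have hxy : x ≤ y := by
    rw [hy, le_update_iff]
    exact ⟨le_rfl, fun j _ => hxx j⟩
  have h₁ := negSign_anti (hf.apply_le (gridPoint_mono hab K hxy) hyi) hη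
  rcases lt_trichotomy (clampPow K (x (.inl i)) + 1) (clampPow K (x' (.inl i))) with h | h | h
  · omega
  · have hdist : ‖(gridPoint hab K x').1 - (gridPoint hab K y).1‖ ≤ δ := by
      refine (pi_norm_le_iff_of_nonneg hδ).2 fun j => ?_
      rw [Pi.sub_apply, gridPoint_apply, gridPoint_apply]
      by_cases hj : j = i
      · subst hj
        have hnn : 0 ≤ (b j - a j) / 2 ^ K :=
          div_nonneg (sub_nonneg.2 (hab j).le) (by positivity)
        rw [hy, Function.update_self, ← h, Real.norm_of_nonneg]
        · push_cast
          linarith [hK j]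
        · push_cast
          linarith
      · rw [hy, Function.update_of_ne (by simpa using hj)]
        simpa using hδ
    have h₂ := hfδ _ _ i hdist
    have h₃ : negSign η (f (gridPoint hab K y) i) ≤
        1 + negSign η (f (gridPoint hab K x') i) := by
      have hb₃ := negSign_bound η (f (gridPoint hab K y) i)
      by_cases h₄ : η < f (gridPoint hab K x') i
      · have := negSign_nonpos (h₂ h₄)
        omega
      · have := negSign_nonneg (not_lt.1 h₄)
        omega
    omega
  · have he : clampPow K (x (.inl i)) = clampPow K (x' (.inl i)) := by omega
    have hxi : (gridPoint hab K x).1 i = (gridPoint hab K x').1 i := by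
      simp [gridPoint_apply, he]
    have := negSign_anti (hf.apply_le (gridPoint_mono hab K hxx) hxi) hη
    omega

/-- Points where all components of `f` are at most `η` in absolute value, for functions that do not
change from above `η` to below `-η` over distances at most `δ`. -/
theorem exists_queryAlg_of_grid {m : ℕ} [Fintype ε] [DecidableEq ε]
    (hε : d + Fintype.card ε = 2 * m + 1) (hab : ∀ i, a i < b i) {K : ℕ} {η δ : ℝ} (hη : 0 ≤ η)
    (hδ : 0 ≤ δ) (hK : ∀ i, (b i - a i) / 2 ^ K ≤ δ) :
    ∃ A : QueryAlg (Set.Icc a b) (Fin d → ℝ), ∀ f : Set.Icc a b → (Fin d → ℝ),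
      PositiveSwitching f → ExDiagonalDecreasing f →
      (∀ x x' i, ‖x.1 - x'.1‖ ≤ δ → η < f x i → -η ≤ f x' i) →
        (∀ i, |f (A.result f) i| ≤ η) ∧
        A.evaluations f ≤ 4 * (2 * m + 1) * (500 * (K + 1)) ^ (m + 1) := by
  have hpow : (0 : ℤ) ≤ 2 ^ K := by positivity
  -- The padding coordinates only take the value `0`.
  obtain ⟨T, hT⟩ := solves_fixedPoint (ι := Fin d ⊕ ε) (by simpa using hε) K 0
    (Sum.elim (fun _ => 2 ^ K) fun _ => 0) (by rintro (i | i) <;> simp)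
    (by rintro (i | i) <;> simp)
  refine ⟨(T.simulate (gridPoint hab K) (gridMove K η) (gridPoint hab K)).toAlg,
    fun f hps hed hfδ => ?_⟩
  rw [QueryTree.result_toAlg, QueryTree.evaluations_toAlg, QueryTree.result_simulate,
    QueryTree.cost_simulate]
  have hlow : 0 ≤ gridMove K η (0 : Fin d ⊕ ε → ℤ) (f (gridPoint hab K (0 : Fin d ⊕ ε → ℤ))) := by
    rintro (i | i)
    · have h := ((hps (gridPoint hab K (0 : Fin d ⊕ ε → ℤ)) i).1 (by
        simp [gridPoint_apply, clampPow_of_mem le_rfl hpow])).trans hη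
      simpa [gridMove, clampPow_of_mem le_rfl hpow] using negSign_nonneg h
    · exact le_rfl
  have hhigh : gridMove K η (Sum.elim (fun _ => 2 ^ K) fun _ => 0 : Fin d ⊕ ε → ℤ)
      (f (gridPoint hab K (Sum.elim (fun _ => 2 ^ K) fun _ => 0 : Fin d ⊕ ε → ℤ))) ≤
        Sum.elim (fun _ => 2 ^ K) fun _ => 0 := by
    rintro (i | i)
    · have h := (neg_nonpos.2 hη).trans
        ((hps (gridPoint hab K (Sum.elim (fun _ => 2 ^ K) fun _ => 0 : Fin d ⊕ ε → ℤ)) i).2 (by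
          rw [gridPoint_apply, Sum.elim_inl, clampPow_of_mem hpow le_rfl]
          push_cast
          rw [mul_div_cancel₀ _ (by positivity)]
          ring))
      simpa [gridMove, clampPow_of_mem hpow le_rfl] using negSign_nonpos h
    · exact le_rfl
  obtain ⟨⟨h₁, h₂, h₃⟩, h₄⟩ := hT (fun x => gridMove K η x (f (gridPoint hab K x)))
    ⟨gridMove_mono hab hη hδ hK hed hfδ, hlow, hhigh⟩
  refine ⟨fun i => abs_le_of_negSign_eq_zero (η := η) ?_, h₄⟩
  have h := congrFun h₃ (.inl i)
  have h₅ := h₁ (.inl i)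
  have h₆ := h₂ (.inl i)
  simp only [gridMove, Sum.elim_inl, Pi.zero_apply] at h h₅ h₆
  rw [clampPow_of_mem h₅ h₆] at h
  exact add_eq_left.1 h

/-- Take `K = ⌈log₂ (D / δ)⌉`; the maximum with `1` lets the constant absorb `log D` and the
rounding. -/
theorem exists_pow_ge_and_le_log (D : ℝ) (hD : 0 < D) :
    ∃ C : ℝ, 0 ≤ C ∧ ∀ δ : ℝ, 0 < δ → ∃ K : ℕ, D / 2 ^ K ≤ δ ∧
      (K : ℝ) + 1 ≤ C * max 1 (Real.log (1 / δ)) := by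
  have h2 : 0 < Real.log 2 := Real.log_pos one_lt_two
  refine ⟨2 + (|Real.log D| + 1) / Real.log 2, by positivity, fun δ hδ => ?_⟩
  set M := max 1 (Real.log (1 / δ)) with hM
  have hM1 : 1 ≤ M := le_max_left _ _
  have hlog : Real.log (D / δ) ≤ |Real.log D| + M := by
    rw [div_eq_mul_one_div, Real.log_mul hD.ne' (by positivity)]
    exact add_le_add (le_abs_self _) (le_max_right _ _)
  refine ⟨⌈Real.log (D / δ) / Real.log 2⌉₊, ?_, ?_⟩
  · have h := Nat.le_ceil (Real.log (D / δ) / Real.log 2)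
    rw [div_le_iff₀ h2, ← Real.log_pow, Real.log_le_log_iff (by positivity) (by positivity),
      div_le_iff₀ hδ] at h
    rw [div_le_iff₀ (by positivity)]
    linarith
  · have h₁ : Real.log (D / δ) / Real.log 2 ≤ (|Real.log D| + M) / Real.log 2 := by gcongr
    have h₂ : (⌈Real.log (D / δ) / Real.log 2⌉₊ : ℝ) ≤ ⌈(|Real.log D| + M) / Real.log 2⌉₊ := by
      exact_mod_cast Nat.ceil_mono h₁
    have h₃ := Nat.ceil_lt_add_one (show 0 ≤ (|Real.log D| + M) / Real.log 2 by positivity)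
    have h₄ : (|Real.log D| + M) / Real.log 2 ≤ (|Real.log D| + 1) / Real.log 2 * M := by
      rw [div_mul_eq_mul_div]
      gcongr
      nlinarith [abs_nonneg (Real.log D)]
    nlinarith

theorem ceil_add_one_div_two (d : ℕ) : ⌈((d : ℝ) + 1) / 2⌉₊ = d / 2 + 1 := by
  rw [Nat.ceil_eq_iff (by omega)]
  have h₁ : ((d / 2 * 2 : ℕ) : ℝ) ≤ d := by exact_mod_cast Nat.div_mul_le_self d 2
  have h₂ : (d : ℝ) ≤ ((d / 2 * 2 + 1 : ℕ) : ℝ) := by exact_mod_cast (by omega)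
  push_cast at h₁ h₂ ⊢
  constructor <;> linarith

/-- Points where all components of `f` are at most `η` in absolute value are found in
`O(log ^ ⌈(d + 1) / 2⌉ (1 / δ))` evaluations, for functions that do not change from above `η` to
below `-η` over distances at most `δ`. -/
theorem exists_queryAlg (hab : ∀ i, a i < b i) :
    ∃ C : ℝ, ∀ δ η : ℝ, 0 < δ → 0 ≤ η → ∃ A : QueryAlg (Set.Icc a b) (Fin d → ℝ),
      ∀ f : Set.Icc a b → (Fin d → ℝ), PositiveSwitching f → ExDiagonalDecreasing f →
        (∀ x x' i, ‖x.1 - x'.1‖ ≤ δ → η < f x i → -η ≤ f x' i) →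
          (∀ i, |f (A.result f) i| ≤ η) ∧
          (A.evaluations f : ℝ) ≤ C * (max 1 (Real.log (1 / δ))) ^ ⌈((d : ℝ) + 1) / 2⌉₊ := by
  have hsum : ∀ i, b i - a i ≤ ∑ j, (b j - a j) := fun i =>
    Finset.single_le_sum (f := fun j => b j - a j) (fun j _ => sub_nonneg.2 (hab j).le)
      (Finset.mem_univ i)
  -- The summand `1` keeps this positive even for `d = 0`.
  have hD : 0 < 1 + ∑ j, (b j - a j) :=
    add_pos_of_pos_of_nonneg one_pos (Finset.sum_nonneg fun j _ => sub_nonneg.2 (hab j).le)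
  obtain ⟨C, hC, hK⟩ := exists_pow_ge_and_le_log _ hD
  rw [ceil_add_one_div_two]
  refine ⟨4 * (2 * (d / 2 : ℕ) + 1) * (500 * C) ^ (d / 2 + 1), fun δ η hδ hη => ?_⟩
  obtain ⟨K, hK₁, hK₂⟩ := hK δ hδ
  -- The padding type has one element for even `d` and none for odd `d`.
  obtain ⟨A, hA⟩ := exists_queryAlg_of_grid (ε := Fin (2 * (d / 2) + 1 - d)) (m := d / 2)
    (by rw [Fintype.card_fin]; omega) hab hη hδ.le
    (fun i => le_trans (by gcongr; linarith [hsum i]) hK₁)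
  refine ⟨A, fun f h₁ h₂ h₃ => ?_⟩
  obtain ⟨h₄, h₅⟩ := hA f h₁ h₂ h₃
  refine ⟨h₄, le_trans (Nat.cast_le.2 h₅) ?_⟩
  push_cast
  rw [mul_assoc (4 * _), ← mul_pow, mul_assoc 500]
  gcongr

end RootFinding

/-! ### The three function classes. -/

theorem mainTheorem1 (d : ℕ) (hd : 2 ≤ d) (a b : Fin d → ℝ) (hab : ∀ i, a i < b i) :
    -- discrete functions
    (∃ C : ℝ, ∀ δ : ℝ, 0 < δ →
      ∃ A : RootFinding.QueryAlg (Set.Icc a b) (Fin d → ℝ),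
        ∀ f : Set.Icc a b → (Fin d → ℝ),
          RootFinding.PositiveSwitching f → RootFinding.ExDiagonalDecreasing f →
          RootFinding.DeltaContinuous δ f →
            RootFinding.IsRoot f (A.result f) ∧
            (A.evaluations f : ℝ) ≤ C * (max 1 (Real.log (1 / δ))) ^ ⌈((d : ℝ) + 1) / 2⌉₊) ∧
    -- functions that satisfy the Lipschitz condition at scale `ε / L`
    (∃ C : ℝ, ∀ ε L : ℝ, 0 < ε → 0 < L →
      ∃ A : RootFinding.QueryAlg (Set.Icc a b) (Fin d → ℝ),
        ∀ f : Set.Icc a b → (Fin d → ℝ),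
          RootFinding.PositiveSwitching f → RootFinding.ExDiagonalDecreasing f →
          RootFinding.ScaleLipschitz ε L f →
            RootFinding.IsApproxRoot ε f (A.result f) ∧
            (A.evaluations f : ℝ) ≤ C * (max 1 (Real.log (L / ε))) ^ ⌈((d : ℝ) + 1) / 2⌉₊) ∧
    -- Lipschitz-continuous functions
    (∃ C : ℝ, ∀ ε L : ℝ, 0 < ε → 0 < L →
      ∃ A : RootFinding.QueryAlg (Set.Icc a b) (Fin d → ℝ),
        ∀ f : Set.Icc a b → (Fin d → ℝ),
          RootFinding.PositiveSwitching f → RootFinding.ExDiagonalDecreasing f →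
          LipschitzWith (Real.toNNReal L) f →
            RootFinding.IsApproxRoot ε f (A.result f) ∧
            (A.evaluations f : ℝ) ≤ C * (max 1 (Real.log (L / ε))) ^ ⌈((d : ℝ) + 1) / 2⌉₊) := by
  obtain ⟨C, hC⟩ := RootFinding.exists_queryAlg hab
  have scale : ∀ ε L : ℝ, 0 < ε → 0 < L →
      ∃ A : RootFinding.QueryAlg (Set.Icc a b) (Fin d → ℝ),
        ∀ f : Set.Icc a b → (Fin d → ℝ),
          RootFinding.PositiveSwitching f → RootFinding.ExDiagonalDecreasing f →
          RootFinding.ScaleLipschitz ε L f →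
            RootFinding.IsApproxRoot ε f (A.result f) ∧
            (A.evaluations f : ℝ) ≤
              C * (max 1 (Real.log (L / ε))) ^ ⌈((d : ℝ) + 1) / 2⌉₊ := by
    intro ε L hε hL
    -- With `η = ε`, a component above `ε` stays positive over distances at most `ε / L`.
    obtain ⟨A, hA⟩ := hC (ε / L) ε (div_pos hε hL) hε.le
    refine ⟨A, fun f h₁ h₂ h₃ => ?_⟩
    obtain ⟨h₄, h₅⟩ := hA f h₁ h₂ fun x x' i hx hxi => by
      have h := (abs_le.1 ((norm_le_pi_norm (f x - f x') i).trans (h₃ x x' hx))).2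
      rw [Pi.sub_apply] at h
      linarith
    rw [one_div_div] at h₅
    exact ⟨(pi_norm_le_iff_of_nonneg hε.le).2 h₄, h₅⟩
  refine ⟨⟨C, fun δ hδ => ?_⟩, ⟨C, scale⟩, ⟨C, fun ε L hε hL => ?_⟩⟩
  · obtain ⟨A, hA⟩ := hC δ 0 hδ le_rfl
    refine ⟨A, fun f h₁ h₂ h₃ => ?_⟩
    obtain ⟨h₄, h₅⟩ := hA f h₁ h₂ fun x x' i hx hxi => by
      have h := (abs_le.1 ((norm_le_pi_norm (f x - f x') i).trans (h₃.2 x x' hx))).2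
      rw [Pi.sub_apply] at h
      rcases h₃.1 x i with h₆ | h₆ | h₆ <;> rcases h₃.1 x' i with h₇ | h₇ | h₇ <;>
        linarith
    exact ⟨funext fun i => abs_nonpos_iff.1 (h₄ i), h₅⟩
  · obtain ⟨A, hA⟩ := scale ε L hε hL
    refine ⟨A, fun f h₁ h₂ h₃ => hA f h₁ h₂ fun x x' hx => ?_⟩
    have h := h₃.dist_le_mul x x'
    rw [dist_eq_norm, Real.coe_toNNReal L hL.le, Subtype.dist_eq, dist_eq_norm] at h
    calc ‖f x - f x'‖ ≤ L * ‖x.1 - x'.1‖ := h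
      _ ≤ L * (ε / L) := by gcongr
      _ = ε := mul_div_cancel₀ _ hL.ne'
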